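/- **Setting.** For $x\in\mathbb C$ write $x^*=\bar x$. All matrix norms are Frobenius norms and all vector norms are Euclidean. For $Q\in\mathbb C^{2\times2}$, "rotate $(x,y)$ by $Q$" means $(x,y)^T\gets Q(x,y)^T$. Fix a unit roundoff $u\ge 0$. "In floating point arithmetic" means that every basic operation $+,-,\times,/$ and every real square root returns its exact result times some $1+\delta$ with $|\delta|\le u$ (where $\delta$ may depend on the operation, is complex for operations on complex numbers and real for operations on real numbers); negation, conjugation and comparison are exact, and $|z|^2$ is evaluated as $(\operatorname{Re}z)^2+(\operatorname{Im}z)^2$. Matrix-vector products with $2\times2$ matrices are evaluated entrywise as sums of two products. **One QR iteration.** Input: $d,p,q\in\mathbb C^n$ and $\beta\in\mathbb C^{n-1}$. *Elimination of the superdiagonal.* Set $\gamma\gets\bar\beta$ and $\tilde q\gets q$. For $k=n,n-1,\dots,2$: 1. Compute $x_1=\beta_{k-1}+p_{k-1}q_k^*$ and $x_2=d_k+p_kq_k^*$, then $c=x_2/\sqrt{|x_1|^2+|x_2|^2}$ and $s=x_1/\sqrt{|x_1|^2+|x_2|^2}$ (with $c=1$, $s=0$ if $x_1=x_2=0$), and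 put $Q_k=\begin{pmatrix}c&-s\\ \bar s&\bar c\end{pmatrix}$. 2. If $k\ne2$, set $\gamma_{k-2}\gets\bigl(Q_k(\gamma_{k-2},\,-\tilde q_kp_{k-2}^*)^T\bigr)_1$. 3. Rotate $(d_{k-1},\gamma_{k-1})$, then $(\beta_{k-1},d_k)$, then $(p_{k-1},p_k)$ by $Q_k$. 4. If $|p_{k-1}q_k^*|^2+|p_kq_k^*|^2>|\beta_{k-1}|^2+|d_k|^2$, set $p_{k-1}\gets-\beta_{k-1}/q_k^*$. 5. Rotate $(\tilde q_{k-1},\tilde q_k)$ by $Q_k$. *Rotation back to Hessenberg form.* With the resulting $d,\gamma,p$ and $Q_2,\dots,Q_n$ and the original $q$, for $k=n,n-1,\dots,2$: set $(d_{k-1},\beta_{k-1})^T\gets\overline{Q_k}\,(d_{k-1},-p_{k-1}q_k^*)^T$; set $d_k\gets\bigl(\overline{Q_k}\,(\gamma_{k-1},d_k)^T\bigr)_2$; rotate $(q_{k-1},q_k)$ by $Q_k$. Output: $d,\beta,p,q$. **Lemma 4.4.** There are a constant $C$ and exponents $a,b\in\mathbb N$ such that for all $n,k\ge0$ there is a $u_0=u_0(n,k)>0$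 with the following property for all $0\le u\le u_0$. Let $A\in\mathbb C^{n\times n}$ be Hermitian and $p,q\in\mathbb C^n$ such that $A+pq^*$ is lower Hessenberg (that is, $(A+pq^*)_{i,j}=0$ for $j>i+1$). Let $d$ and $\beta$ be the diagonal and the superdiagonal of $A$. Suppose that $k$ QR iterations, starting from $d,\beta,p,q$, are carried out in floating point arithmetic, with outputs $\hat d^{(k)},\hat\beta^{(k)},\hat p^{(k)},\hat q^{(k)}$, and define $\hat A^{(k)}\in\mathbb C^{n\times n}$ by $$\hat a^{(k)}_{i,j}=\begin{cases}-\hat p^{(k)}_i\hat q^{(k)*}_j & j>i+1,\\ \hat\beta^{(k)}_i & j=i+1,\\ \hat d^{(k)}_i & j=i,\\ \overline{\hat\beta^{(k)}_j} & j=i-1,\\ -\hat q^{(k)}_i\hat p^{(k)*}_j & j<i-1.\end{cases}$$ Then there exist a unitary matrix $U\in\mathbb C^{n\times n}$, a matrix $\delta A\in\mathbb C^{n\times n}$ and vectors $\delta p,\delta q\in\mathbb C^n$ such that $$\hat A^{(k)}=U(A+\delta A)U^*,\qquad \hat p^{(k)}=U(p+\delta p),\qquad \hat q^{(k)}=U(q+\delta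 q),$$ $$\|\delta A\|\le C n^ak^b\,\|A\|\,u,\qquad \|\delta p\|\le C n^ak^b\,\|p\|\,u,\qquad \|\delta q\|\le C n^ak^b\,\|q\|\,u .$$ -/

import Mathlib

open scoped Matrix ComplexConjugate Matrix.Norms.Frobenius

namespace StructuredQR

/-! ### The floating point model

`IsFl u x y` says that `y` is an admissible floating point value of an operation with exact
(complex) result `x`, when the unit roundoff is `u`. Different operations may have different
relative errors `δ`, so a statement about all admissible values covers every arithmetic
obeying the model. Negation and complex conjugation are exact, as are comparisons of
computed numbers. -/

/-- `y = x (1 + δ)` for some complex `δ` with `|δ| ≤ u`. -/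
def IsFl (u : ℝ) (x y : ℂ) : Prop := ∃ δ : ℂ, ‖δ‖ ≤ u ∧ y = x * (1 + δ)

/-- `y = x (1 + δ)` for some real `δ` with `|δ| ≤ u` (operations on real numbers). -/
def IsFlReal (u : ℝ) (x y : ℝ) : Prop := ∃ δ : ℝ, |δ| ≤ u ∧ y = x * (1 + δ)

/-- `y` is a floating point evaluation of `|z| ^ 2 = (re z) ^ 2 + (im z) ^ 2`. -/
def IsFlAbsSq (u : ℝ) (z : ℂ) (y : ℝ) : Prop :=
  ∃ a b : ℝ, IsFlReal u (z.re * z.re) a ∧ IsFlReal u (z.im * z.im) b ∧ IsFlReal u (a + b) y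

/-- `y` is a floating point evaluation of `|z| ^ 2 + |w| ^ 2`. -/
def IsFlSqSum (u : ℝ) (z w : ℂ) (y : ℝ) : Prop :=
  ∃ a b : ℝ, IsFlAbsSq u z a ∧ IsFlAbsSq u w b ∧ IsFlReal u (a + b) y

/-- `y` is a floating point evaluation of `a + b * c`. -/
def IsFlAddMul (u : ℝ) (a b c y : ℂ) : Prop :=
  ∃ t : ℂ, IsFl u (b * c) t ∧ IsFl u (a + t) y

/-- `y` is a floating point evaluation of `a₁ * x₁ + a₂ * x₂`. -/
def IsFlDot (u : ℝ) (a₁ a₂ x₁ x₂ y : ℂ) : Prop :=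
  ∃ s t : ℂ, IsFl u (a₁ * x₁) s ∧ IsFl u (a₂ * x₂) t ∧ IsFl u (s + t) y

/-- `(y₁, y₂)` is a floating point evaluation of `Q (x₁, x₂)`. -/
def IsFlApply (u : ℝ) (Q : Matrix (Fin 2) (Fin 2) ℂ) (x₁ x₂ y₁ y₂ : ℂ) : Prop :=
  IsFlDot u (Q 0 0) (Q 0 1) x₁ x₂ y₁ ∧ IsFlDot u (Q 1 0) (Q 1 1) x₁ x₂ y₂

/-- `Q` is a floating point evaluation of the rotation in `SU(2)` that eliminates the first
entry of `(x₁, x₂)`: `Q = [c, -s; conj s, conj c]` with `c` and `s` the computed values of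
`x₂ / √(|x₁|² + |x₂|²)` and `x₁ / √(|x₁|² + |x₂|²)`, and `c = 1`, `s = 0` for the zero
vector. -/
def IsFlRotation (u : ℝ) (x₁ x₂ : ℂ) (Q : Matrix (Fin 2) (Fin 2) ℂ) : Prop :=
  ∃ c s : ℂ, Q = !![c, -s; conj s, conj c] ∧
    ((x₁ = 0 ∧ x₂ = 0 ∧ c = 1 ∧ s = 0) ∨
      (¬(x₁ = 0 ∧ x₂ = 0) ∧ ∃ N ρ : ℝ, IsFlSqSum u x₁ x₂ N ∧ IsFlReal u (Real.sqrt N) ρ ∧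
        IsFl u (x₂ / (ρ : ℂ)) c ∧ IsFl u (x₁ / (ρ : ℂ)) s))

/-! ### Generators

Entries of a vector of length `n` are indexed by `Fin n`, entries of a super- or subdiagonal
by `Fin (n - 1)`. The index `j : Fin (n - 1)` also stands for the plane spanned by the
consecutive coordinates `lo j` and `hi j`; in one-based notation it is the `(k - 1, k)`-plane
with `k = j + 2`. -/

/-- The first of the two consecutive coordinates with index `j`. -/
def lo {n : ℕ} (j : Fin (n - 1)) : Fin n := ⟨j.1, by have := j.2; omega⟩

/-- The second of the two consecutive coordinates with index `j`. -/
def hi {n : ℕ} (j : Fin (n - 1)) : Fin n := ⟨j.1 + 1, by have := j.2; omega⟩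

/-- `M` is lower Hessenberg: all its entries above the superdiagonal vanish. -/
def IsLowerHessenberg {n : ℕ} (M : Matrix (Fin n) (Fin n) ℂ) : Prop :=
  ∀ i j : Fin n, i.1 + 1 < j.1 → M i j = 0

/-- The generators (basic elements): diagonal, superdiagonal, and the two vectors of the
rank-one part. -/
@[ext]
structure Generators (n : ℕ) where
  d : Fin n → ℂ
  β : Fin (n - 1) → ℂ
  p : Fin n → ℂ
  q : Fin n → ℂ

/-- The generators of `A + p q*`: the diagonal and the superdiagonal of `A`, and `p`, `q`. -/
def generatorsOf {n : ℕ} (A : Matrix (Fin n) (Fin n) ℂ) (p q : Fin n → ℂ) : Generators n where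
  d := fun i => A i i
  β := fun j => A (lo j) (hi j)
  p := p
  q := q

/-- The matrix represented by the generators: diagonal `d`, superdiagonal `β`, the entries
`-p i * conj (q j)` above the superdiagonal, and below the diagonal the complex conjugates of
the entries in the transposed positions. -/
def Generators.toMatrix {n : ℕ} (g : Generators n) : Matrix (Fin n) (Fin n) ℂ :=
  Matrix.of fun i j =>
    if i = j then g.d i
    else if h : i.1 + 1 = j.1 then g.β ⟨i.1, by have := j.2; omega⟩
    else if i.1 + 1 < j.1 then -(g.p i * conj (g.q j))
    else if h : j.1 + 1 = i.1 then conj (g.β ⟨j.1, by have := i.2; omega⟩)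
    else -(g.q i * conj (g.p j))

/-! ### Elimination of the superdiagonal -/

/-- The variables of the elimination: diagonal, superdiagonal, subdiagonal, `p`, and the
rotated copy `qt` of `q`. -/
structure ElimState (n : ℕ) where
  d : Fin n → ℂ
  β : Fin (n - 1) → ℂ
  γ : Fin (n - 1) → ℂ
  p : Fin n → ℂ
  qt : Fin n → ℂ

/-- One pass `s ↦ s'` through the body of the elimination loop in floating point arithmetic,
in the plane with index `j`; `Q` is the computed rotation. -/
structure IsElimStep {n : ℕ} (u : ℝ) (q : Fin n → ℂ) (j : Fin (n - 1))
    (s : ElimState n) (Q : Matrix (Fin 2) (Fin 2) ℂ) (s' : ElimState n) : Prop where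
  /-- Construct the rotation eliminating the superdiagonal entry of the represented sum. -/
  rotation : ∃ x₁ x₂ : ℂ,
    IsFlAddMul u (s.β j) (s.p (lo j)) (conj (q (hi j))) x₁ ∧
    IsFlAddMul u (s.d (hi j)) (s.p (hi j)) (conj (q (hi j))) x₂ ∧
    IsFlRotation u x₁ x₂ Q
  /-- Rotate the subdiagonal and the sub-subdiagonal (unless this is the last pass). -/
  subdiag : ∀ i : Fin (n - 1), i.1 + 1 = j.1 →
    ∃ t : ℂ, IsFl u (s.qt (hi j) * conj (s.p (lo i))) t ∧
      IsFlDot u (Q 0 0) (Q 0 1) (s.γ i) (-t) (s'.γ i)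
  /-- Rotate the diagonal and the subdiagonal. -/
  diag_sub : IsFlApply u Q (s.d (lo j)) (s.γ j) (s'.d (lo j)) (s'.γ j)
  /-- Rotate the superdiagonal and the diagonal. -/
  sup_diag : IsFlApply u Q (s.β j) (s.d (hi j)) (s'.β j) (s'.d (hi j))
  /-- Rotate `p`, and replace its upper entry by the computed value of `-β / conj q` if, in
  the computed values, `|p_{k-1} conj q_k|² + |p_k conj q_k|² > |β_{k-1}|² + |d_k|²`. -/
  rotate_p : ∃ (y a b : ℂ) (L R : ℝ),
    IsFlApply u Q (s.p (lo j)) (s.p (hi j)) y (s'.p (hi j)) ∧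
    IsFl u (y * conj (q (hi j))) a ∧
    IsFl u (s'.p (hi j) * conj (q (hi j))) b ∧
    IsFlSqSum u a b L ∧
    IsFlSqSum u (s'.β j) (s'.d (hi j)) R ∧
    ((R < L ∧ IsFl u (-(s'.β j) / conj (q (hi j))) (s'.p (lo j))) ∨
      (L ≤ R ∧ s'.p (lo j) = y))
  /-- Rotate the copy of `q`. -/
  rotate_qt : IsFlApply u Q (s.qt (lo j)) (s.qt (hi j)) (s'.qt (lo j)) (s'.qt (hi j))
  /-- All other entries are unchanged. -/
  frame_d : ∀ i, i ≠ lo j → i ≠ hi j → s'.d i = s.d i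
  frame_β : ∀ i, i ≠ j → s'.β i = s.β i
  frame_γ : ∀ i, i ≠ j → i.1 + 1 ≠ j.1 → s'.γ i = s.γ i
  frame_p : ∀ i, i ≠ lo j → i ≠ hi j → s'.p i = s.p i
  frame_qt : ∀ i, i ≠ lo j → i ≠ hi j → s'.qt i = s.qt i

/-- A floating point run of the elimination of the superdiagonal on the generators `g`. The
planes are processed from the last one to the first one; the outputs are the computed
rotations `Q`, the diagonal `d` and subdiagonal `γ`, and the vector `p`. -/
def IsElimination {n : ℕ} (u : ℝ) (g : Generators n)
    (Q : Fin (n - 1) → Matrix (Fin 2) (Fin 2) ℂ)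
    (d : Fin n → ℂ) (γ : Fin (n - 1) → ℂ) (p : Fin n → ℂ) : Prop :=
  ∃ S : ℕ → ElimState n,
    S (n - 1) = ⟨g.d, g.β, fun j => conj (g.β j), g.p, g.q⟩ ∧
    (∀ j : Fin (n - 1), IsElimStep u g.q j (S (j.1 + 1)) (Q j) (S j.1)) ∧
    (S 0).d = d ∧ (S 0).γ = γ ∧ (S 0).p = p

/-! ### Rotation back to Hessenberg form -/

/-- The variables of the rotation back: diagonal, superdiagonal, and `q`. -/
structure BackState (n : ℕ) where
  d : Fin n → ℂ
  β : Fin (n - 1) → ℂ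
  q : Fin n → ℂ

/-- One pass `s ↦ s'` through the body of the loop rotating back, in floating point
arithmetic, in the plane with index `j`. -/
structure IsBackStep {n : ℕ} (u : ℝ) (Q : Matrix (Fin 2) (Fin 2) ℂ)
    (γ : Fin (n - 1) → ℂ) (p : Fin n → ℂ) (j : Fin (n - 1)) (s s' : BackState n) : Prop where
  /-- Rotate the diagonal and the superdiagonal by the conjugate of `Q`. -/
  diag_sup : ∃ t : ℂ, IsFl u (p (lo j) * conj (s.q (hi j))) t ∧
    IsFlApply u (Q.map conj) (s.d (lo j)) (-t) (s'.d (lo j)) (s'.β j)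
  /-- Rotate the subdiagonal and the diagonal by the conjugate of `Q`, keeping the diagonal. -/
  sub_diag : IsFlDot u (conj (Q 1 0)) (conj (Q 1 1)) (γ j) (s.d (hi j)) (s'.d (hi j))
  /-- Rotate `q`. -/
  rotate_q : IsFlApply u Q (s.q (lo j)) (s.q (hi j)) (s'.q (lo j)) (s'.q (hi j))
  /-- All other entries are unchanged. -/
  frame_d : ∀ i, i ≠ lo j → i ≠ hi j → s'.d i = s.d i
  frame_β : ∀ i, i ≠ j → s'.β i = s.β i
  frame_q : ∀ i, i ≠ lo j → i ≠ hi j → s'.q i = s.q i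

/-- A floating point run of the rotation back to Hessenberg form with inputs `Q`, `d`, `γ`,
`p`, `q` and outputs `d'`, `β'`, `q'`. The superdiagonal needs no initial value, since each of
its entries is assigned in the run. -/
def IsRotationBack {n : ℕ} (u : ℝ) (Q : Fin (n - 1) → Matrix (Fin 2) (Fin 2) ℂ)
    (d : Fin n → ℂ) (γ : Fin (n - 1) → ℂ) (p q : Fin n → ℂ)
    (d' : Fin n → ℂ) (β' : Fin (n - 1) → ℂ) (q' : Fin n → ℂ) : Prop :=
  ∃ S : ℕ → BackState n,
    (S (n - 1)).d = d ∧ (S (n - 1)).q = q ∧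
    (∀ j : Fin (n - 1), IsBackStep u (Q j) γ p j (S (j.1 + 1)) (S j.1)) ∧
    (S 0).d = d' ∧ (S 0).β = β' ∧ (S 0).q = q'

/-! ### Iterations of the QR algorithm -/

/-- `g'` is a result of one iteration of the structured QR algorithm (elimination of the
superdiagonal, then rotation back with the computed rotations) on `g`, carried out in floating
point arithmetic with unit roundoff `u`. -/
def IsQRIteration {n : ℕ} (u : ℝ) (g g' : Generators n) : Prop :=
  ∃ (Q : Fin (n - 1) → Matrix (Fin 2) (Fin 2) ℂ) (d : Fin n → ℂ) (γ : Fin (n - 1) → ℂ),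
    IsElimination u g Q d γ g'.p ∧ IsRotationBack u Q d γ g'.p g.q g'.d g'.β g'.q

/-- `g'` is a result of `k` iterations of the structured QR algorithm on `g`, carried out in
floating point arithmetic with unit roundoff `u`. -/
def IsQRIterations {n : ℕ} (u : ℝ) (k : ℕ) (g g' : Generators n) : Prop :=
  ∃ G : ℕ → Generators n, G 0 = g ∧ (∀ l < k, IsQRIteration u (G l) (G (l + 1))) ∧ G k = g'

/-- The Euclidean norm of a vector with complex entries. -/
noncomputable def vecNorm {n : ℕ} (v : Fin n → ℂ) : ℝ := ‖WithLp.toLp 2 v‖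

end StructuredQR

namespace StructuredQR

/-! ### Error bounds for the basic operations -/

/-! The argument is a backward error analysis in which every pass of either loop is compared with an
exact plane rotation of a full matrix. A computed rotation lies within O(u) of an exactly unitary
`G` (`IsFlRotation.spec`), and `G` is used in both loops, so the exact process behind one iteration
is a single unitary similarity. Each computed entry differs from the exactly rotated one by O(u)
times the two entries entering it. Since a rank-one entry -p_i conj(q_m) carries a factor common to
both rows (or both columns), relative errors of the generators become relative errors of the matrix
entries, and neither the product of the norms of p and q nor the accumulated error of the rotated
copy of q enters the bounds.

The delicate point is the eliminated superdiagonal entry, which from then on is represented by -p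
conj(q). The residual of the elimination is small only relative to the sum of the sizes of the
matrix part and the rank-one part. The comparison in the algorithm decides which part dominates: if
the rank-one part does, redefining p from the matrix entry disturbs p only slightly; otherwise
keeping p disturbs the matrix entry only slightly. This is `corrected_entry_bounds`.

Entries no longer stored are free and are chosen to be the exactly rotated ones. Hence the
invariants `ElimTracks` and `BackTracks` constrain only what later passes read, and after one
iteration only the upper triangle is known to be close to the similarity
(`IsQRIteration.exists_unitary`). The lower triangle is filled in by symmetry, but the computed
diagonal need not be real. The deviation from being Hermitian must therefore be followed separately:
by `norm_bounds_of_upper_eq` it passes from one iteration to the next with factor 1, plus a multiple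
of the new error. It grows linearly in the number of iterations, and its sum, the backward error,
grows quadratically. -/

theorem IsFl.norm_sub_le {u : ℝ} {x y : ℂ} (h : IsFl u x y) : ‖y - x‖ ≤ u * ‖x‖ := by
  obtain ⟨δ, hδ, rfl⟩ := h
  rw [show x * (1 + δ) - x = δ * x by ring, norm_mul]
  gcongr

theorem norm_le_of_norm_sub_le {x y : ℂ} {r : ℝ} (h : ‖y - x‖ ≤ r) : ‖y‖ ≤ ‖x‖ + r := by
  have := norm_le_norm_add_norm_sub' y x
  linarith

theorem norm_ge_of_norm_sub_le {x y : ℂ} {r : ℝ} (h : ‖y - x‖ ≤ r) : ‖x‖ ≤ ‖y‖ + r := by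
  rw [norm_sub_rev] at h
  exact norm_le_of_norm_sub_le h

theorem IsFlReal.bounds {u x y : ℝ} (h : IsFlReal u x y) (hx : 0 ≤ x) :
    (1 - u) * x ≤ y ∧ y ≤ (1 + u) * x := by
  obtain ⟨δ, hδ, rfl⟩ := h
  rw [abs_le] at hδ
  constructor <;> nlinarith

theorem IsFlAbsSq.bounds {u y : ℝ} {z : ℂ} (hu : 0 ≤ u) (hu1 : u ≤ 1)
    (h : IsFlAbsSq u z y) :
    (1 - u) ^ 2 * ‖z‖ ^ 2 ≤ y ∧ y ≤ (1 + u) ^ 2 * ‖z‖ ^ 2 := by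
  obtain ⟨a, b, ha, hb, hy⟩ := h
  obtain ⟨ha1, ha2⟩ := ha.bounds (mul_self_nonneg _)
  obtain ⟨hb1, hb2⟩ := hb.bounds (mul_self_nonneg _)
  have hz : ‖z‖ ^ 2 = z.re * z.re + z.im * z.im := by
    rw [Complex.sq_norm, Complex.normSq_apply]
  have h0 : 0 ≤ 1 - u := by linarith
  have ha0 : 0 ≤ a := le_trans (mul_nonneg h0 (mul_self_nonneg _)) ha1
  have hb0 : 0 ≤ b := le_trans (mul_nonneg h0 (mul_self_nonneg _)) hb1
  obtain ⟨hy1, hy2⟩ := hy.bounds (add_nonneg ha0 hb0)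
  rw [hz]
  constructor
  · calc _ = (1 - u) * ((1 - u) * (z.re * z.re) + (1 - u) * (z.im * z.im)) := by ring
      _ ≤ (1 - u) * (a + b) := by gcongr
      _ ≤ y := hy1
  · calc y ≤ (1 + u) * (a + b) := hy2
      _ ≤ (1 + u) * ((1 + u) * (z.re * z.re) + (1 + u) * (z.im * z.im)) := by gcongr
      _ = _ := by ring

theorem IsFlSqSum.bounds {u N : ℝ} {z w : ℂ} (hu : 0 ≤ u) (hu1 : u ≤ 1)
    (h : IsFlSqSum u z w N) :
    (1 - u) ^ 3 * (‖z‖ ^ 2 + ‖w‖ ^ 2) ≤ N ∧ N ≤ (1 + u) ^ 3 * (‖z‖ ^ 2 + ‖w‖ ^ 2) := by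
  obtain ⟨a, b, ha, hb, hy⟩ := h
  obtain ⟨ha1, ha2⟩ := ha.bounds hu hu1
  obtain ⟨hb1, hb2⟩ := hb.bounds hu hu1
  have h0 : 0 ≤ 1 - u := by linarith
  have ha0 : 0 ≤ a := le_trans (by positivity) ha1
  have hb0 : 0 ≤ b := le_trans (by positivity) hb1
  obtain ⟨hy1, hy2⟩ := hy.bounds (add_nonneg ha0 hb0)
  constructor
  · calc _ = (1 - u) * ((1 - u) ^ 2 * ‖z‖ ^ 2 + (1 - u) ^ 2 * ‖w‖ ^ 2) := by ring
      _ ≤ (1 - u) * (a + b) := by gcongr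
      _ ≤ N := hy1
  · calc N ≤ (1 + u) * (a + b) := hy2
      _ ≤ (1 + u) * ((1 + u) ^ 2 * ‖z‖ ^ 2 + (1 + u) ^ 2 * ‖w‖ ^ 2) := by gcongr
      _ = _ := by ring

/-- All later comparisons use sums of moduli; passing from a sum of squares to the square of the sum
costs a factor 2 in the lower bound, whence 9/20. -/
theorem IsFlSqSum.bounds_add_sq {u N : ℝ} {z w : ℂ} (hu : 0 ≤ u) (hu1 : u ≤ 1 / 1000)
    (h : IsFlSqSum u z w N) :
    9 / 20 * (‖z‖ + ‖w‖) ^ 2 ≤ N ∧ N ≤ 11 / 10 * (‖z‖ + ‖w‖) ^ 2 := by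
  obtain ⟨h1, h2⟩ := h.bounds hu (by linarith)
  have hz := norm_nonneg z
  have hw := norm_nonneg w
  have e1 : (9 / 10 : ℝ) ≤ (1 - u) ^ 3 := by
    calc (9 / 10 : ℝ) ≤ (1 - 1 / 1000) ^ 3 := by norm_num
      _ ≤ (1 - u) ^ 3 := by gcongr
  have e2 : (1 + u) ^ 3 ≤ (11 / 10 : ℝ) := by
    calc (1 + u) ^ 3 ≤ (1 + 1 / 1000) ^ 3 := by gcongr
      _ ≤ 11 / 10 := by norm_num
  constructor
  · calc 9 / 20 * (‖z‖ + ‖w‖) ^ 2 ≤ 9 / 10 * (‖z‖ ^ 2 + ‖w‖ ^ 2) := by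
          nlinarith [sq_nonneg (‖z‖ - ‖w‖)]
      _ ≤ (1 - u) ^ 3 * (‖z‖ ^ 2 + ‖w‖ ^ 2) := by gcongr
      _ ≤ N := h1
  · calc N ≤ (1 + u) ^ 3 * (‖z‖ ^ 2 + ‖w‖ ^ 2) := h2
      _ ≤ 11 / 10 * (‖z‖ ^ 2 + ‖w‖ ^ 2) := by gcongr
      _ ≤ _ := by nlinarith [mul_nonneg hz hw]

theorem norm_add_mul_add_le {u : ℝ} {δ ε : ℂ} (hu1 : u ≤ 1) (hδ : ‖δ‖ ≤ u) (hε : ‖ε‖ ≤ u) :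
    ‖δ + ε + δ * ε‖ ≤ 3 * u := by
  have hu : 0 ≤ u := (norm_nonneg _).trans hδ
  calc ‖δ + ε + δ * ε‖ ≤ ‖δ‖ + ‖ε‖ + ‖δ‖ * ‖ε‖ := by
        refine (norm_add_le _ _).trans ?_
        rw [norm_mul]
        gcongr
        exact norm_add_le _ _
    _ ≤ u + u + 1 * u := by gcongr; linarith
    _ = 3 * u := by ring

theorem IsFlDot.norm_sub_le {u : ℝ} {a b x₁ x₂ y : ℂ} (hu1 : u ≤ 1)
    (h : IsFlDot u a b x₁ x₂ y) :
    ‖y - (a * x₁ + b * x₂)‖ ≤ 3 * u * (‖a‖ * ‖x₁‖ + ‖b‖ * ‖x₂‖) := by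
  obtain ⟨s, t, ⟨δ₁, h₁, rfl⟩, ⟨δ₂, h₂, rfl⟩, ⟨δ₃, h₃, rfl⟩⟩ := h
  have e : (a * x₁ * (1 + δ₁) + b * x₂ * (1 + δ₂)) * (1 + δ₃) - (a * x₁ + b * x₂) =
      (δ₁ + δ₃ + δ₁ * δ₃) * (a * x₁) + (δ₂ + δ₃ + δ₂ * δ₃) * (b * x₂) := by ring
  rw [e]
  refine (norm_add_le _ _).trans ?_
  rw [norm_mul, norm_mul _ (b * x₂), norm_mul a, norm_mul b, mul_add]
  gcongr
  · exact norm_add_mul_add_le hu1 h₁ h₃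
  · exact norm_add_mul_add_le hu1 h₂ h₃

theorem IsFlAddMul.norm_sub_le {u : ℝ} {a b c y : ℂ} (hu : 0 ≤ u) (hu1 : u ≤ 1)
    (h : IsFlAddMul u a b c y) :
    ‖y - (a + b * c)‖ ≤ 3 * u * (‖a‖ + ‖b‖ * ‖c‖) := by
  obtain ⟨t, ⟨δ₂, h₂, rfl⟩, ⟨δ₃, h₃, rfl⟩⟩ := h
  have e : (a + b * c * (1 + δ₂)) * (1 + δ₃) - (a + b * c) =
      δ₃ * a + (δ₂ + δ₃ + δ₂ * δ₃) * (b * c) := by ring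
  rw [e]
  refine (norm_add_le _ _).trans ?_
  rw [norm_mul, norm_mul, norm_mul b, mul_add]
  gcongr
  · linarith
  · exact norm_add_mul_add_le hu1 h₂ h₃

/-! ### Computed rotations -/

/-- `G` is unitary and the computed rotation `Q` agrees with it to working accuracy. -/
structure IsNearUnitary (u : ℝ) (Q G : Matrix (Fin 2) (Fin 2) ℂ) : Prop where
  unitary : G ∈ Matrix.unitaryGroup (Fin 2) ℂ
  close : ∀ i j, ‖Q i j - G i j‖ ≤ 11 * u

theorem unitary_of_norm_sq {c s : ℂ} (h : ‖c‖ ^ 2 + ‖s‖ ^ 2 = 1) :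
    (!![c, -s; conj s, conj c] : Matrix (Fin 2) (Fin 2) ℂ) ∈ Matrix.unitaryGroup (Fin 2) ℂ := by
  have h' : c * conj c + s * conj s = 1 := by
    rw [Complex.mul_conj, Complex.mul_conj, Complex.normSq_eq_norm_sq, Complex.normSq_eq_norm_sq]
    exact_mod_cast h
  rw [Matrix.mem_unitaryGroup_iff]
  ext i j
  fin_cases i <;> fin_cases j <;>
    simp [Matrix.mul_apply, Fin.sum_univ_two, Matrix.star_apply] <;>
    first | linear_combination h' | ring

/-- Dividing `c` and `s` by their joint length `w` gives an exact rotation. The change is at most |w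
- 1| ≤ |w² - 1|, so control of the squared length suffices. -/
theorem exists_isNearUnitary_of_norm_sq {u : ℝ} {c s : ℂ} (hu1 : u ≤ 1 / 1000)
    (h : |‖c‖ ^ 2 + ‖s‖ ^ 2 - 1| ≤ 11 * u) :
    ∃ G, IsNearUnitary u !![c, -s; conj s, conj c] G := by
  set w2 := ‖c‖ ^ 2 + ‖s‖ ^ 2 with hw2
  have hw2pos : 0 < w2 := by
    have := (abs_le.1 h).1
    linarith
  set w := Real.sqrt w2 with hw
  have hwpos : 0 < w := Real.sqrt_pos.2 hw2pos
  have hwsq : w ^ 2 = w2 := Real.sq_sqrt hw2pos.le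
  have hw1 : |w - 1| ≤ 11 * u := by
    refine le_trans ?_ h
    rw [← hwsq, show w ^ 2 - 1 = (w - 1) * (w + 1) by ring, abs_mul]
    refine le_mul_of_one_le_right (abs_nonneg _) ?_
    rw [abs_of_pos (by linarith)]
    linarith
  have key : ∀ z : ℂ, ‖z‖ ^ 2 ≤ w2 → ‖z - z / (w : ℂ)‖ ≤ 11 * u := by
    intro z hz
    have hzw : ‖z‖ ≤ w := Real.le_sqrt_of_sq_le hz
    have hwc : (w : ℂ) ≠ 0 := by exact_mod_cast hwpos.ne'
    have e : z - z / (w : ℂ) = z / w * ((w - 1 : ℝ) : ℂ) := by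
      push_cast
      field_simp
    rw [e, norm_mul, norm_div, Complex.norm_real, Complex.norm_real, Real.norm_eq_abs,
      Real.norm_eq_abs, abs_of_pos hwpos]
    calc ‖z‖ / w * |w - 1| ≤ 1 * |w - 1| := by
          gcongr
          exact (div_le_one hwpos).2 hzw
      _ ≤ 11 * u := by linarith
  have hc := key c (by rw [hw2]; nlinarith [sq_nonneg ‖s‖])
  have hs := key s (by rw [hw2]; nlinarith [sq_nonneg ‖c‖])
  have conj_sub : ∀ z : ℂ, ‖conj z - conj (z / (w : ℂ))‖ = ‖z - z / (w : ℂ)‖ := by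
    intro z
    rw [← map_sub, RCLike.norm_conj]
  refine ⟨!![c / w, -(s / w); conj (s / w), conj (c / w)], unitary_of_norm_sq ?_, ?_⟩
  · rw [norm_div, norm_div, Complex.norm_real, Real.norm_eq_abs, div_pow, div_pow, sq_abs, hwsq,
      ← add_div, ← hw2, div_self hw2pos.ne']
  · intro i j
    fin_cases i <;> fin_cases j
    · exact hc
    · change ‖-s - -(s / (w : ℂ))‖ ≤ _
      rw [← norm_neg, neg_sub_neg, neg_sub]
      exact hs
    · change ‖conj s - conj (s / (w : ℂ))‖ ≤ _
      rw [conj_sub]; exact hs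
    · change ‖conj c - conj (c / (w : ℂ))‖ ≤ _
      rw [conj_sub]; exact hc

theorem IsFl.norm_bounds {u : ℝ} {x y : ℂ} (h : IsFl u x y) :
    (1 - u) * ‖x‖ ≤ ‖y‖ ∧ ‖y‖ ≤ (1 + u) * ‖x‖ := by
  have h1 := norm_le_of_norm_sub_le h.norm_sub_le
  have h2 := norm_ge_of_norm_sub_le h.norm_sub_le
  constructor <;> linarith

/-- Both conclusions follow from `c` and `s` sharing the computed denominator `ρ`: its error only
rescales the rotation, and the elimination itself is spoiled only by the two divisions. -/
theorem IsFlRotation.spec {u : ℝ} {x₁ x₂ : ℂ} {Q : Matrix (Fin 2) (Fin 2) ℂ} (hu : 0 ≤ u)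
    (hu1 : u ≤ 1 / 1000) (h : IsFlRotation u x₁ x₂ Q) :
    (∃ G, IsNearUnitary u Q G) ∧ ‖Q 0 0 * x₁ + Q 0 1 * x₂‖ ≤ 4 * u * (‖x₁‖ + ‖x₂‖) := by
  obtain ⟨c, s, rfl, ⟨rfl, rfl, rfl, rfl⟩ | ⟨hx, N, ρ, hN, hρ, hc, hs⟩⟩ := h
  · refine ⟨exists_isNearUnitary_of_norm_sq hu1 ?_, by simp⟩
    simp; linarith
  obtain ⟨hN1, hN2⟩ := hN.bounds hu (by linarith)
  set r := ‖x₁‖ ^ 2 + ‖x₂‖ ^ 2 with hr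
  have hrpos : 0 < r := by
    by_cases h1 : x₁ = 0
    · have h2 : x₂ ≠ 0 := fun h2 => hx ⟨h1, h2⟩
      have := norm_pos_iff.2 h2
      positivity
    · have := norm_pos_iff.2 h1
      positivity
  have h1u : 0 < 1 - u := by linarith
  have hNpos : 0 < N := lt_of_lt_of_le (by positivity) hN1
  obtain ⟨hρ1, hρ2⟩ := hρ.bounds (Real.sqrt_nonneg N)
  have hsq := Real.sq_sqrt hNpos.le
  have hsqpos := Real.sqrt_pos.2 hNpos
  have hρpos : 0 < ρ := lt_of_lt_of_le (by positivity) hρ1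
  have hρc : (ρ : ℂ) ≠ 0 := by exact_mod_cast hρpos.ne'
  -- Three of the five factors come from `N`, two from squaring the rounded square root.
  have hρsq1 : (1 - 5 * u) * r ≤ ρ ^ 2 := by
    calc (1 - 5 * u) * r ≤ (1 - u) ^ 5 * r := by
          gcongr
          have := one_add_mul_le_pow (a := -u) (by linarith) 5
          push_cast at this
          rw [← sub_eq_add_neg] at this
          linarith
      _ = (1 - u) ^ 2 * ((1 - u) ^ 3 * r) := by ring
      _ ≤ (1 - u) ^ 2 * N := by gcongr
      _ = ((1 - u) * √N) ^ 2 := by rw [mul_pow, hsq]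
      _ ≤ ρ ^ 2 := by gcongr
  have hρsq2 : ρ ^ 2 ≤ (1 + 6 * u) * r := by
    calc ρ ^ 2 ≤ ((1 + u) * √N) ^ 2 := by gcongr
      _ = (1 + u) ^ 2 * N := by rw [mul_pow, hsq]
      _ ≤ (1 + u) ^ 2 * ((1 + u) ^ 3 * r) := by gcongr
      _ = (1 + u) ^ 5 * r := by ring
      _ ≤ (1 + 6 * u) * r := by
          gcongr
          have h2 : u ^ 2 ≤ u / 1000 := by nlinarith
          have h3 : u ^ 3 ≤ u / 1000 := by nlinarith
          have h4 : u ^ 4 ≤ u / 1000 := by nlinarith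
          have h5 : u ^ 5 ≤ u / 1000 := by nlinarith
          nlinarith
  have norm_div_rho : ∀ z : ℂ, ‖z / (ρ : ℂ)‖ = ‖z‖ / ρ := by
    intro z
    rw [norm_div, Complex.norm_real, Real.norm_eq_abs, abs_of_pos hρpos]
  obtain ⟨hc1, hc2⟩ := hc.norm_bounds
  obtain ⟨hs1, hs2⟩ := hs.norm_bounds
  rw [norm_div_rho] at hc1 hc2 hs1 hs2
  have low : (1 - u) ^ 2 * r ≤ (‖c‖ ^ 2 + ‖s‖ ^ 2) * ρ ^ 2 := by
    calc (1 - u) ^ 2 * r = (((1 - u) * (‖x₂‖ / ρ)) ^ 2 + ((1 - u) * (‖x₁‖ / ρ)) ^ 2) * ρ ^ 2 := by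
          rw [hr]; field_simp; ring
      _ ≤ _ := by gcongr
  have upp : (‖c‖ ^ 2 + ‖s‖ ^ 2) * ρ ^ 2 ≤ (1 + u) ^ 2 * r := by
    calc _ ≤ (((1 + u) * (‖x₂‖ / ρ)) ^ 2 + ((1 + u) * (‖x₁‖ / ρ)) ^ 2) * ρ ^ 2 := by gcongr
      _ = _ := by rw [hr]; field_simp; ring
  refine ⟨exists_isNearUnitary_of_norm_sq hu1 ?_, ?_⟩
  · set w := ‖c‖ ^ 2 + ‖s‖ ^ 2
    have hw : 0 ≤ w := by positivity
    rw [abs_le]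
    constructor
    · have : (1 - u) ^ 2 * r ≤ w * (1 + 6 * u) * r := by
        calc _ ≤ w * ρ ^ 2 := low
          _ ≤ w * ((1 + 6 * u) * r) := by gcongr
          _ = _ := by ring
      have := le_of_mul_le_mul_right this hrpos
      by_contra hcon
      push Not at hcon
      nlinarith
    · have : w * (1 - 5 * u) * r ≤ (1 + u) ^ 2 * r := by
        calc _ = w * ((1 - 5 * u) * r) := by ring
          _ ≤ w * ρ ^ 2 := by gcongr
          _ ≤ _ := upp
      have := le_of_mul_le_mul_right this hrpos
      by_contra hcon
      push Not at hcon
      nlinarith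
  · obtain ⟨δ₁, h₁, rfl⟩ := hc
    obtain ⟨δ₂, h₂, rfl⟩ := hs
    -- The terms x₁x₂/ρ cancel exactly, leaving the difference of the two division errors.
    have e : (!![x₂ / (ρ : ℂ) * (1 + δ₁), -(x₁ / (ρ : ℂ) * (1 + δ₂));
        conj (x₁ / (ρ : ℂ) * (1 + δ₂)), conj (x₂ / (ρ : ℂ) * (1 + δ₁))] 0 0 * x₁ +
        !![x₂ / (ρ : ℂ) * (1 + δ₁), -(x₁ / (ρ : ℂ) * (1 + δ₂));
        conj (x₁ / (ρ : ℂ) * (1 + δ₂)), conj (x₂ / (ρ : ℂ) * (1 + δ₁))] 0 1 * x₂ : ℂ) =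
        x₁ / (ρ : ℂ) * x₂ * (δ₁ - δ₂) := by
      simp
      ring
    rw [e, norm_mul, norm_mul, norm_div_rho]
    have hx1 : ‖x₁‖ / ρ ≤ 2 := by
      rw [div_le_iff₀ hρpos]
      refine (pow_le_pow_iff_left₀ (norm_nonneg _) (by positivity) two_ne_zero).1 ?_
      nlinarith [sq_nonneg ‖x₂‖]
    calc ‖x₁‖ / ρ * ‖x₂‖ * ‖δ₁ - δ₂‖ ≤ 2 * ‖x₂‖ * (u + u) := by
          gcongr
          exact (norm_sub_le _ _).trans (add_le_add h₁ h₂)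
      _ = 4 * u * ‖x₂‖ := by ring
      _ ≤ 4 * u * (‖x₁‖ + ‖x₂‖) := by
          gcongr
          linarith [norm_nonneg x₁]

/-! ### Applying a computed rotation, compared with the exact unitary matrix -/

/-- The 15 is 11 from replacing the coefficients plus 3 · 4/3 from the arithmetic, the computed
coefficients being at most 4/3 in modulus. -/
theorem IsFlDot.norm_sub_le_of_close {u : ℝ} {a b a' b' x₁ x₂ y : ℂ} (hu1 : u ≤ 1 / 1000)
    (h : IsFlDot u a b x₁ x₂ y) (ha : ‖a - a'‖ ≤ 11 * u) (hb : ‖b - b'‖ ≤ 11 * u)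
    (ha' : ‖a'‖ ≤ 1) (hb' : ‖b'‖ ≤ 1) :
    ‖y - (a' * x₁ + b' * x₂)‖ ≤ 15 * u * (‖x₁‖ + ‖x₂‖) := by
  have hu : 0 ≤ u := by linarith [(norm_nonneg _).trans ha]
  have han := norm_le_of_norm_sub_le ha
  have hbn := norm_le_of_norm_sub_le hb
  have e : y - (a' * x₁ + b' * x₂) =
      (y - (a * x₁ + b * x₂)) + ((a - a') * x₁ + (b - b') * x₂) := by ring
  rw [e]
  calc _ ≤ ‖y - (a * x₁ + b * x₂)‖ + (‖(a - a') * x₁‖ + ‖(b - b') * x₂‖) :=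
        (norm_add_le _ _).trans (add_le_add le_rfl (norm_add_le _ _))
    _ ≤ 3 * u * (‖a‖ * ‖x₁‖ + ‖b‖ * ‖x₂‖) + (11 * u * ‖x₁‖ + 11 * u * ‖x₂‖) := by
        rw [norm_mul, norm_mul]
        gcongr
        exact h.norm_sub_le (by linarith)
    _ ≤ 3 * u * (4 / 3 * ‖x₁‖ + 4 / 3 * ‖x₂‖) + (11 * u * ‖x₁‖ + 11 * u * ‖x₂‖) := by
        gcongr <;> linarith
    _ = _ := by ring

theorem IsFlDot.norm_sub_le_of_close_of_isFl {u : ℝ} {a b a' b' x₁ x₂ t y : ℂ}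
    (hu1 : u ≤ 1 / 1000) (h : IsFlDot u a b x₁ (-t) y) (ht : IsFl u x₂ t)
    (ha : ‖a - a'‖ ≤ 11 * u) (hb : ‖b - b'‖ ≤ 11 * u) (ha' : ‖a'‖ ≤ 1) (hb' : ‖b'‖ ≤ 1) :
    ‖y - (a' * x₁ + b' * (-x₂))‖ ≤ 17 * u * (‖x₁‖ + ‖x₂‖) := by
  have hu : 0 ≤ u := by linarith [(norm_nonneg _).trans ha]
  have h1 := h.norm_sub_le_of_close hu1 ha hb ha' hb'
  rw [norm_neg] at h1
  have h2 := ht.norm_sub_le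
  have h3 := ht.norm_bounds.2
  have e : y - (a' * x₁ + b' * (-x₂)) = (y - (a' * x₁ + b' * (-t))) + b' * (-(t - x₂)) := by ring
  have hx1 := norm_nonneg x₁
  have hx2 := norm_nonneg x₂
  rw [e]
  calc _ ≤ ‖y - (a' * x₁ + b' * (-t))‖ + ‖b'‖ * ‖t - x₂‖ := by
        refine (norm_add_le _ _).trans ?_
        rw [norm_mul, norm_neg]
    _ ≤ 15 * u * (‖x₁‖ + (1 + u) * ‖x₂‖) + 1 * (u * ‖x₂‖) := by
        refine add_le_add (h1.trans ?_) ?_ <;> gcongr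
    _ ≤ 15 * u * (‖x₁‖ + (1 + 1 / 1000) * ‖x₂‖) + 1 * (u * ‖x₂‖) := by gcongr
    _ ≤ _ := by nlinarith [mul_nonneg hu hx1, mul_nonneg hu hx2]

namespace IsNearUnitary

variable {u : ℝ} {Q G : Matrix (Fin 2) (Fin 2) ℂ}

theorem nonneg (h : IsNearUnitary u Q G) : 0 ≤ u := by
  linarith [(norm_nonneg _).trans (h.close 0 0)]

theorem norm_apply_le (h : IsNearUnitary u Q G) (i j : Fin 2) : ‖G i j‖ ≤ 1 :=
  entry_norm_bound_of_unitary h.unitary i j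

theorem map_conj (h : IsNearUnitary u Q G) : IsNearUnitary u (Q.map conj) (G.map conj) where
  unitary := by
    have := h.unitary
    rw [Matrix.mem_unitaryGroup_iff] at this ⊢
    have h2 := congrArg (fun M => M.map (starRingEnd ℂ)) this
    simp only [Matrix.map_mul] at h2
    rw [Matrix.map_one _ (map_zero _) (map_one _)] at h2
    rw [← h2]
    rfl
  close i j := by
    rw [Matrix.map_apply, Matrix.map_apply, ← map_sub, RCLike.norm_conj]
    exact h.close i j

theorem row_norm_sub_le (h : IsNearUnitary u Q G) (hu1 : u ≤ 1 / 1000) (i : Fin 2)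
    {x₁ x₂ y : ℂ} (hy : IsFlDot u (Q i 0) (Q i 1) x₁ x₂ y) :
    ‖y - (G i 0 * x₁ + G i 1 * x₂)‖ ≤ 15 * u * (‖x₁‖ + ‖x₂‖) :=
  hy.norm_sub_le_of_close hu1 (h.close _ _) (h.close _ _) (h.norm_apply_le _ _)
    (h.norm_apply_le _ _)

theorem row_norm_sub_le_of_isFl (h : IsNearUnitary u Q G) (hu1 : u ≤ 1 / 1000) (i : Fin 2)
    {x₁ x₂ t y : ℂ} (hy : IsFlDot u (Q i 0) (Q i 1) x₁ (-t) y) (ht : IsFl u x₂ t) :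
    ‖y - (G i 0 * x₁ + G i 1 * (-x₂))‖ ≤ 17 * u * (‖x₁‖ + ‖x₂‖) :=
  hy.norm_sub_le_of_close_of_isFl hu1 ht (h.close _ _) (h.close _ _) (h.norm_apply_le _ _)
    (h.norm_apply_le _ _)

theorem norm_row_le (h : IsNearUnitary u Q G) (i : Fin 2) (x₁ x₂ : ℂ) :
    ‖G i 0 * x₁ + G i 1 * x₂‖ ≤ ‖x₁‖ + ‖x₂‖ := by
  refine (norm_add_le _ _).trans ?_
  rw [norm_mul, norm_mul]
  exact add_le_add (mul_le_of_le_one_left (norm_nonneg _) (h.norm_apply_le _ _))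
    (mul_le_of_le_one_left (norm_nonneg _) (h.norm_apply_le _ _))

/-- The inverse of `G` is its conjugate transpose, whose entries are again bounded by 1; summing the
two recovered coordinates gives the factor 2. -/
theorem norm_le_rows (h : IsNearUnitary u Q G) (x₁ x₂ : ℂ) :
    ‖x₁‖ + ‖x₂‖ ≤ 2 * (‖G 0 0 * x₁ + G 0 1 * x₂‖ + ‖G 1 0 * x₁ + G 1 1 * x₂‖) := by
  set y₁ := G 0 0 * x₁ + G 0 1 * x₂ with hy₁
  set y₂ := G 1 0 * x₁ + G 1 1 * x₂ with hy₂
  have hG := Matrix.mem_unitaryGroup_iff'.1 h.unitary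
  have e : ∀ i j, conj (G 0 i) * G 0 j + conj (G 1 i) * G 1 j =
      (1 : Matrix (Fin 2) (Fin 2) ℂ) i j := by
    intro i j
    rw [← hG, Matrix.mul_apply, Fin.sum_univ_two]
    rfl
  have h00 := e 0 0
  have h01 := e 0 1
  have h10 := e 1 0
  have h11 := e 1 1
  rw [Matrix.one_apply_eq] at h00 h11
  rw [Matrix.one_apply_ne (by decide)] at h01 h10
  have e1 : x₁ = conj (G 0 0) * y₁ + conj (G 1 0) * y₂ := by
    rw [hy₁, hy₂]; linear_combination (-x₁) * h00 - x₂ * h01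
  have e2 : x₂ = conj (G 0 1) * y₁ + conj (G 1 1) * y₂ := by
    rw [hy₁, hy₂]; linear_combination (-x₁) * h10 - x₂ * h11
  have bd : ∀ i, ‖conj (G 0 i) * y₁ + conj (G 1 i) * y₂‖ ≤ ‖y₁‖ + ‖y₂‖ := by
    intro i
    refine (norm_add_le _ _).trans ?_
    rw [norm_mul, norm_mul, RCLike.norm_conj, RCLike.norm_conj]
    exact add_le_add (mul_le_of_le_one_left (norm_nonneg _) (h.norm_apply_le _ _))
      (mul_le_of_le_one_left (norm_nonneg _) (h.norm_apply_le _ _))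
  have b1 := bd 0
  have b2 := bd 1
  rw [← e1] at b1
  rw [← e2] at b2
  linarith

/-- These two-sided bounds let the algorithm's test on rotated quantities decide about the unrotated
ones; 11/5 is the exact-rotation factor 2 with room for rounding. -/
theorem apply_norm_bounds (h : IsNearUnitary u Q G) (hu1 : u ≤ 1 / 1000) {x₁ x₂ y₁ y₂ : ℂ}
    (hy : IsFlApply u Q x₁ x₂ y₁ y₂) :
    ‖x₁‖ + ‖x₂‖ ≤ 11 / 5 * (‖y₁‖ + ‖y₂‖) ∧ ‖y₁‖ + ‖y₂‖ ≤ 11 / 5 * (‖x₁‖ + ‖x₂‖) := by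
  have hu := h.nonneg
  have c1 := h.row_norm_sub_le hu1 0 hy.1
  have c2 := h.row_norm_sub_le hu1 1 hy.2
  have a1 := norm_le_of_norm_sub_le c1
  have a2 := norm_le_of_norm_sub_le c2
  have b1 := norm_ge_of_norm_sub_le c1
  have b2 := norm_ge_of_norm_sub_le c2
  have r1 := h.norm_row_le 0 x₁ x₂
  have r2 := h.norm_row_le 1 x₁ x₂
  have r3 := h.norm_le_rows x₁ x₂
  have hX : 0 ≤ ‖x₁‖ + ‖x₂‖ := by positivity
  have : 15 * u * (‖x₁‖ + ‖x₂‖) ≤ 15 / 1000 * (‖x₁‖ + ‖x₂‖) := by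
    gcongr
    linarith
  constructor <;> linarith

end IsNearUnitary

/-! ### The correction of p -/

/-- The magnitudes of the summands of the rotated sum are compared correctly up to a constant
by the computed quantities. -/
theorem le_of_sqSum_le {u L R : ℝ} {z₁ z₂ w₁ w₂ : ℂ} (hu : 0 ≤ u) (hu1 : u ≤ 1 / 1000)
    (hL : IsFlSqSum u z₁ z₂ L) (hR : IsFlSqSum u w₁ w₂ R) (h : R ≤ L) :
    ‖w₁‖ + ‖w₂‖ ≤ 8 / 5 * (‖z₁‖ + ‖z₂‖) := by
  have h1 := (hL.bounds_add_sq hu hu1).2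
  have h2 := (hR.bounds_add_sq hu hu1).1
  have hz : 0 ≤ ‖z₁‖ + ‖z₂‖ := by positivity
  have hw : 0 ≤ ‖w₁‖ + ‖w₂‖ := by positivity
  -- The constant works because (8/5)² exceeds (11/10)/(9/20) = 22/9.
  by_contra hcon
  push Not at hcon
  nlinarith

/-- The residual of the elimination of the superdiagonal by the exact unitary matrix `G` close
to the computed rotation. -/
theorem elimination_residual {u : ℝ} {Q G : Matrix (Fin 2) (Fin 2) ℂ} (h : IsNearUnitary u Q G)
    (hu1 : u ≤ 1 / 1000) {β d p₁ p₂ q x₁ x₂ : ℂ} (h₁ : IsFlAddMul u β p₁ q x₁)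
    (h₂ : IsFlAddMul u d p₂ q x₂)
    (hQ : ‖Q 0 0 * x₁ + Q 0 1 * x₂‖ ≤ 4 * u * (‖x₁‖ + ‖x₂‖)) :
    ‖(G 0 0 * β + G 0 1 * d) + (G 0 0 * p₁ + G 0 1 * p₂) * q‖ ≤
      20 * u * ((‖β‖ + ‖d‖) + (‖p₁‖ + ‖p₂‖) * ‖q‖) := by
  have hu := h.nonneg
  have c1 := h₁.norm_sub_le hu (by linarith)
  have c2 := h₂.norm_sub_le hu (by linarith)
  set S := (‖β‖ + ‖d‖) + (‖p₁‖ + ‖p₂‖) * ‖q‖ with hS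
  have hSpos : 0 ≤ S := by positivity
  have n1 : ‖β + p₁ * q‖ ≤ ‖β‖ + ‖p₁‖ * ‖q‖ := (norm_add_le _ _).trans_eq (by rw [norm_mul])
  have n2 : ‖d + p₂ * q‖ ≤ ‖d‖ + ‖p₂‖ * ‖q‖ := (norm_add_le _ _).trans_eq (by rw [norm_mul])
  have m1 := norm_le_of_norm_sub_le c1
  have m2 := norm_le_of_norm_sub_le c2
  have hX : ‖x₁‖ + ‖x₂‖ ≤ 101 / 100 * S := by
    have : u * S ≤ 1 / 1000 * S := by gcongr
    rw [hS] at this ⊢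
    nlinarith
  -- Three sources of error: forming x₁ and x₂, replacing `Q` by `G`, and the residual of the
  -- computed rotation itself.
  have e : (G 0 0 * β + G 0 1 * d) + (G 0 0 * p₁ + G 0 1 * p₂) * q =
      (G 0 0 * (-(x₁ - (β + p₁ * q))) + G 0 1 * (-(x₂ - (d + p₂ * q)))) +
        (-((Q 0 0 - G 0 0) * x₁ + (Q 0 1 - G 0 1) * x₂) + (Q 0 0 * x₁ + Q 0 1 * x₂)) := by ring
  rw [e]
  have t1 := h.norm_row_le 0 (-(x₁ - (β + p₁ * q))) (-(x₂ - (d + p₂ * q)))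
  rw [norm_neg, norm_neg] at t1
  have t2 : ‖(Q 0 0 - G 0 0) * x₁ + (Q 0 1 - G 0 1) * x₂‖ ≤ 11 * u * ‖x₁‖ + 11 * u * ‖x₂‖ := by
    refine (norm_add_le _ _).trans ?_
    rw [norm_mul, norm_mul]
    gcongr
    · exact h.close _ _
    · exact h.close _ _
  have huX : u * (‖x₁‖ + ‖x₂‖) ≤ u * (101 / 100 * S) := by gcongr
  have t3 := norm_add_le (G 0 0 * (-(x₁ - (β + p₁ * q))) + G 0 1 * (-(x₂ - (d + p₂ * q))))
    (-((Q 0 0 - G 0 0) * x₁ + (Q 0 1 - G 0 1) * x₂) + (Q 0 0 * x₁ + Q 0 1 * x₂))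
  have t4 := norm_add_le (-((Q 0 0 - G 0 0) * x₁ + (Q 0 1 - G 0 1) * x₂))
    (Q 0 0 * x₁ + Q 0 1 * x₂)
  rw [norm_neg] at t4
  have huS : 0 ≤ u * S := mul_nonneg hu hSpos
  have : 3 * u * (‖β‖ + ‖p₁‖ * ‖q‖) + 3 * u * (‖d‖ + ‖p₂‖ * ‖q‖) = 3 * (u * S) := by
    rw [hS]; ring
  linarith

/-- After the correction, the upper entry of the rotated `p` is accurate, and the represented
superdiagonal entry of the rotated matrix is accurate as well. -/
theorem corrected_entry_bounds {u L R : ℝ} {Q G : Matrix (Fin 2) (Fin 2) ℂ}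
    (h : IsNearUnitary u Q G) (hu1 : u ≤ 1 / 1000)
    {β d p₁ p₂ q x₁ x₂ β' d' y p₁' p₂' a b : ℂ} (h₁ : IsFlAddMul u β p₁ q x₁)
    (h₂ : IsFlAddMul u d p₂ q x₂)
    (hQ : ‖Q 0 0 * x₁ + Q 0 1 * x₂‖ ≤ 4 * u * (‖x₁‖ + ‖x₂‖))
    (hβ : IsFlApply u Q β d β' d') (hp : IsFlApply u Q p₁ p₂ y p₂')
    (ha : IsFl u (y * q) a) (hb : IsFl u (p₂' * q) b)
    (hL : IsFlSqSum u a b L) (hR : IsFlSqSum u β' d' R)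
    (hcor : (R < L ∧ IsFl u (-β' / q) p₁') ∨ (L ≤ R ∧ p₁' = y)) :
    ‖p₁' - (G 0 0 * p₁ + G 0 1 * p₂)‖ ≤ 500 * u * (‖p₁‖ + ‖p₂‖) ∧
      ‖-(p₁' * q) - (G 0 0 * β + G 0 1 * d)‖ ≤ 500 * u * (‖β‖ + ‖d‖) := by
  have hu := h.nonneg
  have res := elimination_residual h hu1 h₁ h₂ hQ
  obtain ⟨bβ1, bβ2⟩ := h.apply_norm_bounds hu1 hβ
  obtain ⟨bp1, bp2⟩ := h.apply_norm_bounds hu1 hp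
  have cβ := h.row_norm_sub_le hu1 0 hβ.1
  have cp := h.row_norm_sub_le hu1 0 hp.1
  obtain ⟨a1, a2⟩ := ha.norm_bounds
  obtain ⟨b1, b2⟩ := hb.norm_bounds
  rw [norm_mul] at a1 a2 b1 b2
  set gβ := G 0 0 * β + G 0 1 * d
  set gp := G 0 0 * p₁ + G 0 1 * p₂
  set D := ‖β‖ + ‖d‖ with hD
  set P := ‖p₁‖ + ‖p₂‖ with hP
  have hDpos : 0 ≤ D := by positivity
  have hPpos : 0 ≤ P := by positivity
  have hq := norm_nonneg q
  have hPq : 0 ≤ P * ‖q‖ := by positivity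
  have hyq : 0 ≤ (‖y‖ + ‖p₂'‖) * ‖q‖ := by positivity
  have hyq2 : (‖y‖ + ‖p₂'‖) * ‖q‖ ≤ 11 / 5 * (P * ‖q‖) := by
    rw [← mul_assoc]; gcongr
  have hyq1 : P * ‖q‖ ≤ 11 / 5 * ((‖y‖ + ‖p₂'‖) * ‖q‖) := by
    rw [← mul_assoc]; gcongr
  have huyq : u * ((‖y‖ + ‖p₂'‖) * ‖q‖) ≤ 1 / 1000 * ((‖y‖ + ‖p₂'‖) * ‖q‖) := by gcongr
  have ab2 : ‖a‖ + ‖b‖ ≤ 101 / 100 * ((‖y‖ + ‖p₂'‖) * ‖q‖) := by linarith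
  have ab1 : (‖y‖ + ‖p₂'‖) * ‖q‖ ≤ 101 / 100 * (‖a‖ + ‖b‖) := by linarith
  have cyq : ‖(y - gp) * q‖ ≤ 15 * u * P * ‖q‖ := by rw [norm_mul]; gcongr
  -- In the first case `D` ≤ 10 `P`|q|, so the residual is O(u) relative to `P`|q| and may be
  -- charged to p; in the second `P`|q| ≤ 10 `D`, and it may be charged to the matrix entry.
  rcases hcor with ⟨hlt, hp₁'⟩ | ⟨hle, rfl⟩
  · have hDP : D ≤ 10 * (P * ‖q‖) := by
      have := le_of_sqSum_le hu hu1 hL hR hlt.le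
      linarith
    -- If q vanished, so would a and b, giving L ≤ 0 ≤ R against the strict inequality.
    have hq0 : q ≠ 0 := by
      rintro rfl
      rw [norm_zero, mul_zero] at ab2 hyq2
      have h0 : ‖a‖ + ‖b‖ = 0 := le_antisymm (by linarith) (by positivity)
      have hL2 := (hL.bounds_add_sq hu hu1).2
      have hR1 := (hR.bounds_add_sq hu hu1).1
      rw [h0] at hL2
      have : 0 ≤ 9 / 20 * (‖β'‖ + ‖d'‖) ^ 2 := by positivity
      linarith
    have hqpos := norm_pos_iff.2 hq0
    obtain ⟨δ, hδ, rfl⟩ := hp₁'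
    have hδ1 : ‖1 + δ‖ ≤ 101 / 100 := by
      have := norm_add_le 1 δ
      rw [norm_one] at this
      linarith
    -- With `D` ≤ 10 `P`|q|: 150 from rotating β, 15 from rotating p, and 20 · 11 from the residual.
    have hres : ‖β' + y * q‖ ≤ 385 * u * P * ‖q‖ := by
      have e : β' + y * q = (β' - gβ) + ((y - gp) * q + (gβ + gp * q)) := by ring
      have t1 := norm_add_le (β' - gβ) ((y - gp) * q + (gβ + gp * q))
      have t2 := norm_add_le ((y - gp) * q) (gβ + gp * q)
      have : u * D ≤ u * (10 * (P * ‖q‖)) := by gcongr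
      have : 0 ≤ u * (P * ‖q‖) := by positivity
      rw [e]
      linarith
    have hgp : ‖gp‖ ≤ P := h.norm_row_le 0 p₁ p₂
    have hy : ‖y‖ ≤ 2 * P := by
      have := norm_le_of_norm_sub_le cp
      have : u * P ≤ 1 / 1000 * P := by gcongr
      linarith
    constructor
    · have e : -β' / q * (1 + δ) - gp = (y - gp) + (-((β' + y * q) / q * (1 + δ)) + y * δ) := by
        field_simp
        ring
      have t1 := norm_add_le (y - gp) (-((β' + y * q) / q * (1 + δ)) + y * δ)
      have t2 := norm_add_le (-((β' + y * q) / q * (1 + δ))) (y * δ)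
      have t3 : ‖-((β' + y * q) / q * (1 + δ))‖ ≤ 385 * u * P * (101 / 100) := by
        rw [norm_neg, norm_mul, norm_div]
        gcongr
        rwa [div_le_iff₀ hqpos]
      have t4 : ‖y * δ‖ ≤ 2 * P * u := by
        rw [norm_mul]
        gcongr
      have : 0 ≤ u * P := by positivity
      rw [e]
      linarith
    -- The factor q cancels, so the represented entry is β' up to one rounding; no residual enters
    -- here.
    · have e : -(-β' / q * (1 + δ) * q) - gβ = (β' - gβ) + β' * δ := by
        field_simp
        ring
      have t1 := norm_add_le (β' - gβ) (β' * δ)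
      have t2 : ‖β' * δ‖ ≤ 11 / 5 * D * u := by
        rw [norm_mul]
        gcongr
        linarith [norm_nonneg d']
      have : 0 ≤ u * D := by positivity
      rw [e]
      linarith
  · have hPD : P * ‖q‖ ≤ 10 * D := by
      have := le_of_sqSum_le hu hu1 hR hL hle
      linarith
    constructor
    · refine cp.trans ?_
      gcongr
      norm_num
    -- Here p is merely rotated, and the matrix entry absorbs the residual: 10 · 15 + 20 · 11 = 370
    -- in total.
    · have e : -(p₁' * q) - gβ = -((p₁' - gp) * q + (gβ + gp * q)) := by ring
      have t2 := norm_add_le ((p₁' - gp) * q) (gβ + gp * q)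
      have : u * (P * ‖q‖) ≤ u * (10 * D) := by gcongr
      have : 0 ≤ u * D := by positivity
      rw [e, norm_neg]
      linarith

/-! ### The Frobenius norm -/

section Frobenius

variable {m n : Type*} [Fintype m] [Fintype n]

theorem frobenius_norm_sq (M : Matrix m n ℂ) : ‖M‖ ^ 2 = ∑ i, ∑ j, ‖M i j‖ ^ 2 := by
  have h : 0 ≤ ∑ i, ∑ j, ‖M i j‖ ^ 2 := by positivity
  rw [Matrix.frobenius_norm_def, ← Real.sqrt_eq_rpow]
  simp only [Real.rpow_two]
  exact Real.sq_sqrt h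

/-- The trace form reduces unitary invariance to cancelling `Uᴴ * U`. -/
theorem ofReal_frobenius_norm_sq (M : Matrix m n ℂ) :
    ((‖M‖ ^ 2 : ℝ) : ℂ) = (Mᴴ * M).trace := by
  rw [frobenius_norm_sq, Finset.sum_comm]
  simp only [Matrix.trace, Matrix.diag, Matrix.mul_apply, Matrix.conjTranspose_apply]
  push_cast
  refine Finset.sum_congr rfl fun j _ => Finset.sum_congr rfl fun i _ => ?_
  rw [← Complex.ofReal_pow, ← Complex.normSq_eq_norm_sq, Complex.normSq_eq_conj_mul_self]
  rfl

theorem norm_unitary_mul [DecidableEq m] {U : Matrix m m ℂ} (hU : U ∈ Matrix.unitaryGroup m ℂ)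
    (M : Matrix m n ℂ) : ‖U * M‖ = ‖M‖ := by
  have h : ‖U * M‖ ^ 2 = ‖M‖ ^ 2 := by
    have hU' : Uᴴ * U = 1 := Matrix.mem_unitaryGroup_iff'.1 hU
    apply Complex.ofReal_injective
    rw [ofReal_frobenius_norm_sq, ofReal_frobenius_norm_sq, Matrix.conjTranspose_mul,
      Matrix.mul_assoc, ← Matrix.mul_assoc Uᴴ, hU', Matrix.one_mul]
  exact (pow_left_inj₀ (norm_nonneg _) (norm_nonneg _) two_ne_zero).1 h

theorem norm_mul_conjTranspose_unitary [DecidableEq n] {U : Matrix n n ℂ} (hU : U ∈ Matrix.unitaryGroup n ℂ)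
    (M : Matrix m n ℂ) : ‖M * Uᴴ‖ = ‖M‖ := by
  rw [← Matrix.frobenius_norm_conjTranspose, Matrix.conjTranspose_mul,
    Matrix.conjTranspose_conjTranspose, norm_unitary_mul hU, Matrix.frobenius_norm_conjTranspose]

theorem norm_unitary_conj [DecidableEq m] {U : Matrix m m ℂ} (hU : U ∈ Matrix.unitaryGroup m ℂ)
    (M : Matrix m m ℂ) : ‖U * M * Uᴴ‖ = ‖M‖ := by
  rw [norm_mul_conjTranspose_unitary hU, norm_unitary_mul hU]

end Frobenius

/-! ### Rotations in a coordinate plane -/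

theorem lo_ne_hi {n : ℕ} (j : Fin (n - 1)) : lo j ≠ hi j := by
  simp [lo, hi]

/-- The `n × n` matrix acting as `G` in the plane with index `j`. -/
def planeRotation {n : ℕ} (j : Fin (n - 1)) (G : Matrix (Fin 2) (Fin 2) ℂ) :
    Matrix (Fin n) (Fin n) ℂ :=
  Matrix.of fun i m =>
    if i = lo j then (if m = lo j then G 0 0 else if m = hi j then G 0 1 else 0)
    else if i = hi j then (if m = lo j then G 1 0 else if m = hi j then G 1 1 else 0)
    else if i = m then 1 else 0

section PlaneRotation

variable {n : ℕ} {m : Type*} (j : Fin (n - 1)) (G : Matrix (Fin 2) (Fin 2) ℂ)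

theorem planeRotation_mul_lo (M : Matrix (Fin n) m ℂ) (k : m) :
    (planeRotation j G * M) (lo j) k = G 0 0 * M (lo j) k + G 0 1 * M (hi j) k := by
  rw [Matrix.mul_apply, Fintype.sum_eq_add (lo j) (hi j) (lo_ne_hi j)]
  · simp [planeRotation, (lo_ne_hi j).symm]
  · rintro x ⟨h1, h2⟩
    simp [planeRotation, h1, h2]

theorem planeRotation_mul_hi (M : Matrix (Fin n) m ℂ) (k : m) :
    (planeRotation j G * M) (hi j) k = G 1 0 * M (lo j) k + G 1 1 * M (hi j) k := by
  rw [Matrix.mul_apply, Fintype.sum_eq_add (lo j) (hi j) (lo_ne_hi j)]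
  · simp [planeRotation, (lo_ne_hi j).symm]
  · rintro x ⟨h1, h2⟩
    simp [planeRotation, h1, h2]

theorem planeRotation_mul_of_ne (M : Matrix (Fin n) m ℂ) (k : m) {i : Fin n} (h1 : i ≠ lo j)
    (h2 : i ≠ hi j) : (planeRotation j G * M) i k = M i k := by
  rw [Matrix.mul_apply, Fintype.sum_eq_single i]
  · simp [planeRotation, h1, h2]
  · intro x hx
    simp [planeRotation, h1, h2, hx.symm]

theorem conjTranspose_planeRotation : (planeRotation j G)ᴴ = planeRotation j Gᴴ := by
  ext a b
  simp only [planeRotation, Matrix.conjTranspose_apply, Matrix.of_apply]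
  have hne := lo_ne_hi j
  have hne' := hne.symm
  by_cases a1 : a = lo j
  · subst a1
    by_cases b1 : b = lo j
    · subst b1; simp
    · by_cases b2 : b = hi j
      · subst b2; simp [hne']
      · simp [b1, b2]
  · by_cases a2 : a = hi j
    · subst a2
      by_cases b1 : b = lo j
      · subst b1; simp [hne']
      · by_cases b2 : b = hi j
        · subst b2; simp [hne']
        · simp [b1, b2]
    · by_cases b1 : b = lo j
      · subst b1; simp [a1, a2]
      · by_cases b2 : b = hi j
        · subst b2; simp [a1, a2, hne']
        · simp [a1, a2, b1, b2, eq_comm (a := a), apply_ite]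

variable {G}

theorem planeRotation_mem_unitaryGroup (hG : G ∈ Matrix.unitaryGroup (Fin 2) ℂ) :
    planeRotation j G ∈ Matrix.unitaryGroup (Fin n) ℂ := by
  have hG' : G * Gᴴ = 1 := Matrix.mem_unitaryGroup_iff.1 hG
  have e : ∀ a b, G a 0 * Gᴴ 0 b + G a 1 * Gᴴ 1 b = (1 : Matrix (Fin 2) (Fin 2) ℂ) a b := by
    intro a b
    rw [← hG', Matrix.mul_apply, Fin.sum_univ_two]
  rw [Matrix.mem_unitaryGroup_iff, Matrix.star_eq_conjTranspose, conjTranspose_planeRotation]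
  ext a b
  have hne := lo_ne_hi j
  have val : ∀ i m, planeRotation j Gᴴ i m =
      if i = lo j then (if m = lo j then Gᴴ 0 0 else if m = hi j then Gᴴ 0 1 else 0)
      else if i = hi j then (if m = lo j then Gᴴ 1 0 else if m = hi j then Gᴴ 1 1 else 0)
      else if i = m then 1 else 0 := fun _ _ => rfl
  by_cases h1 : a = lo j
  · subst h1
    rw [planeRotation_mul_lo, val, val, if_pos rfl, if_neg hne.symm, if_pos rfl]
    by_cases h3 : b = lo j
    · subst h3
      simp only [if_true, e, Matrix.one_apply_eq]
    · by_cases h4 : b = hi j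
      · subst h4
        simp only [if_true, if_neg hne.symm, e, Matrix.one_apply_ne hne]
        simp
      · simp only [if_neg h3, if_neg h4, Matrix.one_apply_ne (Ne.symm h3)]
        simp
  · by_cases h2 : a = hi j
    · subst h2
      rw [planeRotation_mul_hi, val, val, if_pos rfl, if_neg hne.symm, if_pos rfl]
      by_cases h3 : b = lo j
      · subst h3
        simp only [if_true, e, Matrix.one_apply_ne hne.symm]
        simp
      · by_cases h4 : b = hi j
        · subst h4
          simp only [if_true, if_neg hne.symm, e, Matrix.one_apply_eq]
        · simp only [if_neg h3, if_neg h4, Matrix.one_apply_ne (Ne.symm h4)]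
          simp
    · rw [planeRotation_mul_of_ne _ _ _ _ h1 h2, val, if_neg h1, if_neg h2, Matrix.one_apply]

variable (G) [Fintype m]

/-- Errors that are small relative to the two affected entries of every column are small in the
Frobenius norm. -/
theorem norm_sub_planeRotation_mul_le {ε : ℝ} (hε : 0 ≤ ε) {M M' : Matrix (Fin n) m ℂ}
    (hlo : ∀ k, ‖M' (lo j) k - (G 0 0 * M (lo j) k + G 0 1 * M (hi j) k)‖ ≤
      ε * (‖M (lo j) k‖ + ‖M (hi j) k‖))
    (hhi : ∀ k, ‖M' (hi j) k - (G 1 0 * M (lo j) k + G 1 1 * M (hi j) k)‖ ≤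
      ε * (‖M (lo j) k‖ + ‖M (hi j) k‖))
    (hne : ∀ i, i ≠ lo j → i ≠ hi j → ∀ k, M' i k = M i k) :
    ‖M' - planeRotation j G * M‖ ≤ 2 * ε * ‖M‖ := by
  refine (pow_le_pow_iff_left₀ (norm_nonneg _) (by positivity) two_ne_zero).1 ?_
  rw [mul_pow, frobenius_norm_sq, frobenius_norm_sq, Finset.sum_comm,
    Finset.sum_comm (f := fun i k => ‖M i k‖ ^ 2), Finset.mul_sum]
  refine Finset.sum_le_sum fun k _ => ?_
  rw [Fintype.sum_eq_add (lo j) (hi j) (lo_ne_hi j)]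
  · have hsub : ‖M (lo j) k‖ ^ 2 + ‖M (hi j) k‖ ^ 2 ≤ ∑ i, ‖M i k‖ ^ 2 := by
      rw [← Finset.sum_pair (f := fun i => ‖M i k‖ ^ 2) (lo_ne_hi j)]
      exact Finset.sum_le_sum_of_subset_of_nonneg (Finset.subset_univ _)
        fun _ _ _ => by positivity
    rw [Matrix.sub_apply, Matrix.sub_apply, planeRotation_mul_lo, planeRotation_mul_hi]
    have h1 := pow_le_pow_left₀ (norm_nonneg _) (hlo k) 2
    have h2 := pow_le_pow_left₀ (norm_nonneg _) (hhi k) 2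
    -- Two affected rows together with (a + b)² ≤ 2(a² + b²) account for the factor 2ε.
    calc _ ≤ (ε * (‖M (lo j) k‖ + ‖M (hi j) k‖)) ^ 2 + (ε * (‖M (lo j) k‖ + ‖M (hi j) k‖)) ^ 2 :=
          add_le_add h1 h2
      _ ≤ (2 * ε) ^ 2 * (‖M (lo j) k‖ ^ 2 + ‖M (hi j) k‖ ^ 2) := by
          nlinarith [mul_nonneg (sq_nonneg ε) (sq_nonneg (‖M (lo j) k‖ - ‖M (hi j) k‖))]
      _ ≤ _ := by gcongr
  · rintro i ⟨h1, h2⟩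
    rw [Matrix.sub_apply, planeRotation_mul_of_ne _ _ _ _ h1 h2, hne i h1 h2, sub_self]
    simp

/-- The transposed version of `norm_sub_planeRotation_mul_le`. -/
theorem norm_sub_mul_planeRotation_le {ε : ℝ} (hε : 0 ≤ ε) {M M' : Matrix m (Fin n) ℂ}
    (hlo : ∀ k, ‖M' k (lo j) - (conj (G 0 0) * M k (lo j) + conj (G 0 1) * M k (hi j))‖ ≤
      ε * (‖M k (lo j)‖ + ‖M k (hi j)‖))
    (hhi : ∀ k, ‖M' k (hi j) - (conj (G 1 0) * M k (lo j) + conj (G 1 1) * M k (hi j))‖ ≤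
      ε * (‖M k (lo j)‖ + ‖M k (hi j)‖))
    (hne : ∀ i, i ≠ lo j → i ≠ hi j → ∀ k, M' k i = M k i) :
    ‖M' - M * (planeRotation j G)ᴴ‖ ≤ 2 * ε * ‖M‖ := by
  rw [← Matrix.frobenius_norm_conjTranspose, ← Matrix.frobenius_norm_conjTranspose M,
    Matrix.conjTranspose_sub, Matrix.conjTranspose_mul, Matrix.conjTranspose_conjTranspose]
  have tr : ∀ a b x y z : ℂ, ‖conj z - (a * conj x + b * conj y)‖ =
      ‖z - (conj a * x + conj b * y)‖ := by
    intro a b x y z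
    rw [← RCLike.norm_conj]
    simp
  refine norm_sub_planeRotation_mul_le j G hε (fun k => ?_) (fun k => ?_) ?_
  · change ‖conj _ - (_ * conj _ + _ * conj _)‖ ≤ ε * (‖conj _‖ + ‖conj _‖)
    rw [tr, RCLike.norm_conj, RCLike.norm_conj]
    exact hlo k
  · change ‖conj _ - (_ * conj _ + _ * conj _)‖ ≤ ε * (‖conj _‖ + ‖conj _‖)
    rw [tr, RCLike.norm_conj, RCLike.norm_conj]
    exact hhi k
  · intro i h1 h2 k
    rw [Matrix.conjTranspose_apply, Matrix.conjTranspose_apply, hne i h1 h2]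

end PlaneRotation

/-! ### The matrix represented during the elimination -/

/-- `B` is a matrix represented by the elimination state `s` before the pass through the plane
of the coordinates `t - 1` and `t`. The entries of `B` to the left of the subdiagonal in the
rows below `t` are arbitrary. -/
structure ElimTracks {n : ℕ} (q : Fin n → ℂ) (t : ℕ) (s : ElimState n)
    (B : Matrix (Fin n) (Fin n) ℂ) : Prop where
  diag : ∀ i, B i i = s.d i
  sub : ∀ j, B (hi j) (lo j) = s.γ j
  sup : ∀ j : Fin (n - 1), j.1 < t → B (lo j) (hi j) = s.β j
  upper : ∀ i m : Fin n, i.1 < m.1 → (t ≤ i.1 ∨ i.1 + 1 < m.1) → B i m = -(s.p i * conj (q m))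
  lower : ∀ i m : Fin n, m.1 + 1 < i.1 → i.1 ≤ t → B i m = -(s.qt i * conj (s.p m))

theorem ElimTracks.toMatrix {n : ℕ} (g : Generators n) :
    ElimTracks g.q (n - 1) ⟨g.d, g.β, fun j => conj (g.β j), g.p, g.q⟩ g.toMatrix where
  diag i := by simp [Generators.toMatrix]
  sub j := by
    simp only [Generators.toMatrix, Matrix.of_apply, lo, hi]
    rw [if_neg (by simp), dif_neg (by omega), if_neg (by omega), dif_pos trivial]
  sup j _ := by simp [Generators.toMatrix, lo, hi]
  upper i m h1 h2 := by
    have := m.2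
    have h3 : i ≠ m := fun h => by rw [h] at h1; omega
    simp only [Generators.toMatrix, Matrix.of_apply]
    rw [if_neg h3, dif_neg (by omega), if_pos (by omega)]
  lower i m h1 _ := by
    have h3 : i ≠ m := fun h => by rw [h] at h1; omega
    simp only [Generators.toMatrix, Matrix.of_apply]
    rw [if_neg h3, dif_neg (by omega), if_neg (by omega), dif_neg (by omega)]

/-- The common factor `w` pulls out of the whole row combination, so an error relative to the two
generator entries is the same relative error of the two rank-one matrix entries. -/
theorem norm_row_error_mul_le {ε : ℝ} {g₁ g₂ z x₁ x₂ w : ℂ}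
    (h : ‖z - (g₁ * x₁ + g₂ * x₂)‖ ≤ ε * (‖x₁‖ + ‖x₂‖)) :
    ‖-(z * w) - (g₁ * -(x₁ * w) + g₂ * -(x₂ * w))‖ ≤ ε * (‖-(x₁ * w)‖ + ‖-(x₂ * w)‖) := by
  have e : -(z * w) - (g₁ * -(x₁ * w) + g₂ * -(x₂ * w)) =
      -((z - (g₁ * x₁ + g₂ * x₂)) * w) := by ring
  rw [e, norm_neg, norm_neg, norm_neg, norm_mul, norm_mul, norm_mul, ← add_mul, ← mul_assoc]
  gcongr

section ElimStep

variable {n : ℕ} {u : ℝ} {q : Fin n → ℂ} {j : Fin (n - 1)} {s s' : ElimState n}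
  {Q G : Matrix (Fin 2) (Fin 2) ℂ} {B : Matrix (Fin n) (Fin n) ℂ}

theorem IsElimStep.exists_isNearUnitary (h : IsElimStep u q j s Q s') (hu : 0 ≤ u)
    (hu1 : u ≤ 1 / 1000) : ∃ G, IsNearUnitary u Q G := by
  obtain ⟨x₁, x₂, -, -, hr⟩ := h.rotation
  exact (hr.spec hu hu1).1

theorem IsElimStep.corrected_entry (h : IsElimStep u q j s Q s') (hG : IsNearUnitary u Q G)
    (hu1 : u ≤ 1 / 1000) :
    ‖s'.p (lo j) - (G 0 0 * s.p (lo j) + G 0 1 * s.p (hi j))‖ ≤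
        500 * u * (‖s.p (lo j)‖ + ‖s.p (hi j)‖) ∧
      ‖-(s'.p (lo j) * conj (q (hi j))) - (G 0 0 * s.β j + G 0 1 * s.d (hi j))‖ ≤
        500 * u * (‖s.β j‖ + ‖s.d (hi j)‖) := by
  obtain ⟨x₁, x₂, hx₁, hx₂, hr⟩ := h.rotation
  obtain ⟨y, a, b, L, R, hp, ha, hb, hL, hR, hcor⟩ := h.rotate_p
  exact corrected_entry_bounds hG hu1 hx₁ hx₂ (hr.spec hG.nonneg hu1).2 h.sup_diag hp ha hb hL hR
    hcor

theorem IsElimStep.lower_p_entry (h : IsElimStep u q j s Q s') (hG : IsNearUnitary u Q G)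
    (hu1 : u ≤ 1 / 1000) :
    ‖s'.p (hi j) - (G 1 0 * s.p (lo j) + G 1 1 * s.p (hi j))‖ ≤
      500 * u * (‖s.p (lo j)‖ + ‖s.p (hi j)‖) := by
  obtain ⟨y, a, b, L, R, hp, -⟩ := h.rotate_p
  have hu := hG.nonneg
  refine (hG.row_norm_sub_le hu1 1 hp.2).trans ?_
  gcongr
  norm_num

theorem IsElimStep.norm_p_sub_le (h : IsElimStep u q j s Q s') (hG : IsNearUnitary u Q G)
    (hu1 : u ≤ 1 / 1000) :
    ‖Matrix.replicateCol Unit s'.p - planeRotation j G * Matrix.replicateCol Unit s.p‖ ≤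
      1000 * u * ‖Matrix.replicateCol Unit s.p‖ := by
  have hu := hG.nonneg
  have := norm_sub_planeRotation_mul_le j G (ε := 500 * u) (by positivity)
    (M := Matrix.replicateCol Unit s.p) (M' := Matrix.replicateCol Unit s'.p)
    (fun _ => (h.corrected_entry hG hu1).1) (fun _ => h.lower_p_entry hG hu1)
    (fun i h1 h2 _ => h.frame_p i h1 h2)
  linarith

/-- Every column of the represented matrix is rotated accurately. -/
theorem IsElimStep.exists_column (h : IsElimStep u q j s Q s') (hG : IsNearUnitary u Q G)
    (hu1 : u ≤ 1 / 1000) (hB : ElimTracks q (j.1 + 1) s B) (m : Fin n) :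
    ∃ y₁ y₂ : ℂ,
      ‖y₁ - (G 0 0 * B (lo j) m + G 0 1 * B (hi j) m)‖ ≤
        500 * u * (‖B (lo j) m‖ + ‖B (hi j) m‖) ∧
      ‖y₂ - (G 1 0 * B (lo j) m + G 1 1 * B (hi j) m)‖ ≤
        500 * u * (‖B (lo j) m‖ + ‖B (hi j) m‖) ∧
      (m = lo j → y₁ = s'.d (lo j) ∧ y₂ = s'.γ j) ∧
      (m = hi j → y₁ = -(s'.p (lo j) * conj (q m)) ∧ y₂ = s'.d (hi j)) ∧
      (j.1 + 1 < m.1 → y₁ = -(s'.p (lo j) * conj (q m)) ∧ y₂ = -(s'.p (hi j) * conj (q m))) ∧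
      (∀ i, lo i = m → i.1 + 1 = j.1 → y₁ = s'.γ i) ∧
      (m.1 + 1 < j.1 → y₁ = -(s'.qt (lo j) * conj (s'.p m))) := by
  have hu := hG.nonneg
  have weaken : ∀ (c : ℝ) (x y : ℂ), c ≤ 500 → c * u * (‖x‖ + ‖y‖) ≤ 500 * u * (‖x‖ + ‖y‖) := by
    intro c x y hc
    gcongr
  have zero_le : ∀ (z x y : ℂ), ‖z - z‖ ≤ 500 * u * (‖x‖ + ‖y‖) := by
    intro z x y
    rw [sub_self, norm_zero]
    positivity
  have hlo : (lo j).1 = j.1 := rfl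
  have hhi : (hi j).1 = j.1 + 1 := rfl
  rcases lt_trichotomy m.1 j.1 with hm | hm | hm
  · have hm1 : m ≠ lo j := fun e => by rw [e] at hm; omega
    have hm2 : m ≠ hi j := fun e => by rw [e] at hm; omega
    rcases Nat.lt_or_ge (m.1 + 1) j.1 with hm' | hm'
    -- The lower entry of such a column leaves the tracked region, so the underscore takes the
    -- exactly rotated value and contributes no error.
    · refine ⟨-(s'.qt (lo j) * conj (s'.p m)), _, ?_, zero_le _ _ _, fun e => absurd e hm1,
        fun e => absurd e hm2, fun e => by omega, fun i hi1 hi2 => ?_, fun _ => rfl⟩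
      · rw [h.frame_p m hm1 hm2, hB.lower (lo j) m (by omega) (by omega),
          hB.lower (hi j) m (by omega) (by omega)]
        exact norm_row_error_mul_le ((hG.row_norm_sub_le hu1 0 h.rotate_qt.1).trans
          (weaken _ _ _ (by norm_num)))
      · rw [← hi1] at hm'
        change i.1 + 1 < j.1 at hm'
        omega
    · have hmn : m.1 < n - 1 := by omega
      obtain ⟨i, rfl⟩ : ∃ i : Fin (n - 1), lo i = m := ⟨⟨m.1, hmn⟩, rfl⟩
      have hij : i.1 + 1 = j.1 := by
        change i.1 < j.1 at hm
        change j.1 ≤ i.1 + 1 at hm'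
        omega
      have hhl : hi i = lo j := Fin.ext hij
      refine ⟨s'.γ i, _, ?_, zero_le _ _ _, fun e => absurd e hm1,
        fun e => absurd e hm2, fun e => by omega, fun i' hi1 hi2 => ?_, fun e => by omega⟩
      -- The column just left of the plane combines the stored subdiagonal entry with a rank-one
      -- entry two below the diagonal, which is formed with one extra rounding.
      · obtain ⟨t, ht, hdot⟩ := h.subdiag i hij
        rw [← hhl, hB.sub i, hB.lower (hi j) (lo i) (by omega) (by omega), norm_neg]
        exact (hG.row_norm_sub_le_of_isFl hu1 0 hdot ht).trans (weaken _ _ _ (by norm_num))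
      · have : i' = i := by
          apply Fin.ext
          omega
        rw [this]
  · obtain rfl : m = lo j := Fin.ext hm
    refine ⟨s'.d (lo j), s'.γ j, ?_, ?_, fun _ => ⟨rfl, rfl⟩,
        fun e => absurd e (lo_ne_hi j), fun e => by omega, fun i hi1 hi2 => ?_, fun e => by omega⟩
    · rw [hB.diag, hB.sub]
      exact (hG.row_norm_sub_le hu1 0 h.diag_sub.1).trans (weaken _ _ _ (by norm_num))
    · rw [hB.diag, hB.sub]
      exact (hG.row_norm_sub_le hu1 1 h.diag_sub.2).trans (weaken _ _ _ (by norm_num))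
    · have := congrArg Fin.val hi1
      change i.1 = j.1 at this
      omega
  · have no_sub : ∀ i : Fin (n - 1), lo i = m → i.1 + 1 ≠ j.1 := by
      intro i hi1
      rw [← hi1] at hm
      change j.1 < i.1 at hm
      omega
    have hm1 : m ≠ lo j := fun e => by rw [e] at hm; omega
    rcases Nat.lt_or_ge (j.1 + 1) m.1 with hm' | hm'
    · have hm2 : m ≠ hi j := fun e => by rw [e] at hm'; omega
      refine ⟨-(s'.p (lo j) * conj (q m)), -(s'.p (hi j) * conj (q m)), ?_, ?_,
        fun e => absurd e hm1, fun e => absurd e hm2, fun _ => ⟨rfl, rfl⟩,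
        fun i hi1 hi2 => absurd hi2 (no_sub i hi1), fun e => by omega⟩
      · rw [hB.upper (lo j) m (by omega) (by omega), hB.upper (hi j) m (by omega) (by omega)]
        exact norm_row_error_mul_le (h.corrected_entry hG hu1).1
      · rw [hB.upper (lo j) m (by omega) (by omega), hB.upper (hi j) m (by omega) (by omega)]
        exact norm_row_error_mul_le (h.lower_p_entry hG hu1)
    · obtain rfl : m = hi j := Fin.ext (by omega)
      refine ⟨-(s'.p (lo j) * conj (q (hi j))), s'.d (hi j), ?_, ?_,
        fun e => absurd e hm1, fun _ => ⟨rfl, rfl⟩, fun e => by omega,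
        fun i hi1 hi2 => absurd hi2 (no_sub i hi1), fun e => by omega⟩
      -- The representation changes here: the rotated superdiagonal entry is now given by -p
      -- conj(q), which is accurate only because of the correction.
      · rw [hB.diag, hB.sup j (by omega)]
        exact (h.corrected_entry hG hu1).2
      · rw [hB.diag, hB.sup j (by omega)]
        exact (hG.row_norm_sub_le hu1 1 h.sup_diag.2).trans (weaken _ _ _ (by norm_num))

/-- The columns are independent, so the accurate two-entry columns can be pasted into one matrix;
1000 is twice the 500 of a single entry. -/
theorem IsElimStep.exists_elimTracks (h : IsElimStep u q j s Q s') (hG : IsNearUnitary u Q G)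
    (hu1 : u ≤ 1 / 1000) (hB : ElimTracks q (j.1 + 1) s B) :
    ∃ B', ElimTracks q j.1 s' B' ∧ ‖B' - planeRotation j G * B‖ ≤ 1000 * u * ‖B‖ := by
  have hu := hG.nonneg
  choose y₁ y₂ e₁ e₂ hcol_lo hcol_hi hcol_right hcol_sub hcol_left using
    h.exists_column hG hu1 hB
  have hlo : (lo j).1 = j.1 := rfl
  have hhi : (hi j).1 = j.1 + 1 := rfl
  obtain ⟨B', B'_lo, B'_hi, B'_ne⟩ : ∃ B' : Matrix (Fin n) (Fin n) ℂ,
      (∀ m, B' (lo j) m = y₁ m) ∧ (∀ m, B' (hi j) m = y₂ m) ∧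
        ∀ i, i ≠ lo j → i ≠ hi j → ∀ m, B' i m = B i m := by
    refine ⟨Matrix.of fun i m => if i = lo j then y₁ m else if i = hi j then y₂ m else B i m,
      fun m => ?_, fun m => ?_, fun i h1 h2 m => ?_⟩
    · simp
    · simp [(lo_ne_hi j).symm]
    · simp [h1, h2]
  refine ⟨B', ⟨fun i => ?_, fun i => ?_, fun i hi' => ?_, fun i m h1 h2 => ?_,
    fun i m h1 h2 => ?_⟩, ?_⟩
  · by_cases hi1 : i = lo j
    · rw [hi1, B'_lo, (hcol_lo _ rfl).1]
    · by_cases hi2 : i = hi j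
      · rw [hi2, B'_hi, (hcol_hi _ rfl).2]
      · rw [B'_ne i hi1 hi2, hB.diag, h.frame_d i hi1 hi2]
  · by_cases hi1 : hi i = lo j
    · rw [hi1, B'_lo]
      exact hcol_sub _ i rfl (congrArg Fin.val hi1)
    · by_cases hi2 : hi i = hi j
      · obtain rfl : i = j := Fin.ext (Nat.succ_injective (congrArg Fin.val hi2))
        rw [B'_hi, (hcol_lo _ rfl).2]
      · rw [B'_ne _ hi1 hi2, hB.sub, h.frame_γ]
        · exact fun e => hi2 (by rw [e])
        · exact fun e => hi1 (Fin.ext e)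
  · have h1 : lo i ≠ lo j := fun e => by
      have : i.1 = j.1 := congrArg (Fin.val (n := n)) e
      omega
    have h2 : lo i ≠ hi j := fun e => by
      have : i.1 = j.1 + 1 := congrArg Fin.val e
      omega
    rw [B'_ne _ h1 h2, hB.sup i (by omega), h.frame_β]
    exact fun e => h1 (by rw [e])
  · by_cases hi1 : i = lo j
    · subst hi1
      rw [B'_lo]
      rcases Nat.lt_or_ge (j.1 + 1) m.1 with hm | hm
      · exact (hcol_right m hm).1
      · exact (hcol_hi m (Fin.ext (by omega))).1
    · by_cases hi2 : i = hi j
      · subst hi2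
        rw [B'_hi]
        exact (hcol_right m (by omega)).2
      · have hne1 : i.1 ≠ j.1 := fun e => hi1 (Fin.ext e)
        have hne2 : i.1 ≠ j.1 + 1 := fun e => hi2 (Fin.ext e)
        rw [B'_ne i hi1 hi2, hB.upper i m h1 (by omega), h.frame_p i hi1 hi2]
  · by_cases hi1 : i = lo j
    · subst hi1
      rw [B'_lo]
      exact hcol_left m (by omega)
    · have hne1 : i.1 ≠ j.1 := fun e => hi1 (Fin.ext e)
      have hi2 : i ≠ hi j := fun e => by rw [e] at h2; omega
      have hm1 : m ≠ lo j := fun e => by rw [e] at h1; omega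
      have hm2 : m ≠ hi j := fun e => by rw [e] at h1; omega
      rw [B'_ne i hi1 hi2, hB.lower i m h1 (by omega), h.frame_qt i hi1 hi2,
        h.frame_p m hm1 hm2]
  · have := norm_sub_planeRotation_mul_le j G (ε := 500 * u) (by positivity) (M := B) (M' := B')
      (fun m => by rw [B'_lo]; exact e₁ m) (fun m => by rw [B'_hi]; exact e₂ m) B'_ne
    linarith

end ElimStep

/-! ### The matrix represented during the rotation back -/

/-- `B` is a matrix represented by the state `s` of the rotation back before the pass through
the plane of the coordinates `t - 1` and `t`. The entries of `B` below the subdiagonal and those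
on the subdiagonal in the columns from `t` on are arbitrary. -/
structure BackTracks {n : ℕ} (γ : Fin (n - 1) → ℂ) (p : Fin n → ℂ) (t : ℕ) (s : BackState n)
    (B : Matrix (Fin n) (Fin n) ℂ) : Prop where
  diag : ∀ i, B i i = s.d i
  sub : ∀ j : Fin (n - 1), j.1 < t → B (hi j) (lo j) = γ j
  sup : ∀ j : Fin (n - 1), t ≤ j.1 → B (lo j) (hi j) = s.β j
  upper : ∀ i m : Fin n, i.1 < m.1 → (m.1 ≤ t ∨ i.1 + 1 < m.1) →
    B i m = -(p i * conj (s.q m))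

section BackStep

variable {n : ℕ} {u : ℝ} {γ : Fin (n - 1) → ℂ} {p : Fin n → ℂ} {j : Fin (n - 1)}
  {s s' : BackState n} {Q G : Matrix (Fin 2) (Fin 2) ℂ} {B : Matrix (Fin n) (Fin n) ℂ}

theorem IsBackStep.norm_q_sub_le (h : IsBackStep u Q γ p j s s') (hG : IsNearUnitary u Q G)
    (hu1 : u ≤ 1 / 1000) :
    ‖Matrix.replicateCol Unit s'.q - planeRotation j G * Matrix.replicateCol Unit s.q‖ ≤
      1000 * u * ‖Matrix.replicateCol Unit s.q‖ := by
  have hu := hG.nonneg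
  have := norm_sub_planeRotation_mul_le j G (ε := 15 * u) (by positivity)
    (M := Matrix.replicateCol Unit s.q) (M' := Matrix.replicateCol Unit s'.q)
    (fun _ => hG.row_norm_sub_le hu1 0 h.rotate_q.1)
    (fun _ => hG.row_norm_sub_le hu1 1 h.rotate_q.2)
    (fun i h1 h2 _ => h.frame_q i h1 h2)
  exact this.trans (mul_le_mul_of_nonneg_right (by linarith) (norm_nonneg _))

theorem norm_conj_row_error_mul_le {ε : ℝ} {g₁ g₂ z x₁ x₂ w : ℂ}
    (h : ‖z - (g₁ * x₁ + g₂ * x₂)‖ ≤ ε * (‖x₁‖ + ‖x₂‖)) :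
    ‖-(w * conj z) - (conj g₁ * -(w * conj x₁) + conj g₂ * -(w * conj x₂))‖ ≤
      ε * (‖-(w * conj x₁)‖ + ‖-(w * conj x₂)‖) := by
  have h' : ‖conj z - (conj g₁ * conj x₁ + conj g₂ * conj x₂)‖ ≤ ε * (‖conj x₁‖ + ‖conj x₂‖) := by
    rw [← map_mul, ← map_mul, ← map_add, ← map_sub, RCLike.norm_conj, RCLike.norm_conj,
      RCLike.norm_conj]
    exact h
  simp only [mul_comm w]
  exact norm_row_error_mul_le h'

/-- Every row of the represented matrix is rotated accurately. -/
theorem IsBackStep.exists_row (h : IsBackStep u Q γ p j s s') (hG : IsNearUnitary u Q G)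
    (hu1 : u ≤ 1 / 1000) (hB : BackTracks γ p (j.1 + 1) s B) (i : Fin n) :
    ∃ y₁ y₂ : ℂ,
      ‖y₁ - (conj (G 0 0) * B i (lo j) + conj (G 0 1) * B i (hi j))‖ ≤
        17 * u * (‖B i (lo j)‖ + ‖B i (hi j)‖) ∧
      ‖y₂ - (conj (G 1 0) * B i (lo j) + conj (G 1 1) * B i (hi j))‖ ≤
        17 * u * (‖B i (lo j)‖ + ‖B i (hi j)‖) ∧
      (i = lo j → y₁ = s'.d (lo j) ∧ y₂ = s'.β j) ∧
      (i = hi j → y₂ = s'.d (hi j)) ∧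
      (i.1 < j.1 → y₁ = -(p i * conj (s'.q (lo j))) ∧ y₂ = -(p i * conj (s'.q (hi j)))) := by
  have hu := hG.nonneg
  have weaken : ∀ (x y : ℂ), 15 * u * (‖x‖ + ‖y‖) ≤ 17 * u * (‖x‖ + ‖y‖) := by
    intro x y
    gcongr
    norm_num
  have zero_le : ∀ (z x y : ℂ), ‖z - z‖ ≤ 17 * u * (‖x‖ + ‖y‖) := by
    intro z x y
    rw [sub_self, norm_zero]
    positivity
  have hlo : (lo j).1 = j.1 := rfl
  have hhi : (hi j).1 = j.1 + 1 := rfl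
  have hGc := hG.map_conj
  rcases lt_trichotomy i.1 j.1 with hi' | hi' | hi'
  · refine ⟨-(p i * conj (s'.q (lo j))), -(p i * conj (s'.q (hi j))), ?_, ?_,
      fun e => by rw [e] at hi'; omega, fun e => by rw [e] at hi'; omega, fun _ => ⟨rfl, rfl⟩⟩
    · rw [hB.upper i (lo j) (by omega) (by omega), hB.upper i (hi j) (by omega) (by omega)]
      exact norm_conj_row_error_mul_le
        ((hG.row_norm_sub_le hu1 0 h.rotate_q.1).trans (weaken _ _))
    · rw [hB.upper i (lo j) (by omega) (by omega), hB.upper i (hi j) (by omega) (by omega)]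
      exact norm_conj_row_error_mul_le
        ((hG.row_norm_sub_le hu1 1 h.rotate_q.2).trans (weaken _ _))
  · obtain rfl : i = lo j := Fin.ext hi'
    obtain ⟨t, ht, hdot⟩ := h.diag_sup
    refine ⟨s'.d (lo j), s'.β j, ?_, ?_, fun _ => ⟨rfl, rfl⟩, fun e => absurd e (lo_ne_hi j),
      fun e => by omega⟩
    · rw [hB.diag, hB.upper (lo j) (hi j) (by omega) (by omega), norm_neg]
      exact hGc.row_norm_sub_le_of_isFl hu1 0 hdot.1 ht
    · rw [hB.diag, hB.upper (lo j) (hi j) (by omega) (by omega), norm_neg]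
      exact hGc.row_norm_sub_le_of_isFl hu1 1 hdot.2 ht
  · by_cases hi2 : i = hi j
    · subst hi2
      -- The entry left of the diagonal falls below the tracked triangle and is taken to be exact.
      refine ⟨_, s'.d (hi j), zero_le _ _ _, ?_, fun e => absurd e (lo_ne_hi j).symm,
        fun _ => rfl, fun e => by omega⟩
      rw [hB.diag, hB.sub j (by omega)]
      exact (hGc.row_norm_sub_le hu1 1 h.sub_diag).trans (weaken _ _)
    · exact ⟨_, _, zero_le _ _ _, zero_le _ _ _, fun e => by rw [e] at hi'; omega,
        fun e => absurd e hi2, fun e => by omega⟩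

theorem IsBackStep.exists_backTracks (h : IsBackStep u Q γ p j s s') (hG : IsNearUnitary u Q G)
    (hu1 : u ≤ 1 / 1000) (hB : BackTracks γ p (j.1 + 1) s B) :
    ∃ B', BackTracks γ p j.1 s' B' ∧ ‖B' - B * (planeRotation j G)ᴴ‖ ≤ 1000 * u * ‖B‖ := by
  have hu := hG.nonneg
  choose y₁ y₂ e₁ e₂ hrow_lo hrow_hi hrow_up using h.exists_row hG hu1 hB
  have hlo : (lo j).1 = j.1 := rfl
  have hhi : (hi j).1 = j.1 + 1 := rfl
  obtain ⟨B', B'_lo, B'_hi, B'_ne⟩ : ∃ B' : Matrix (Fin n) (Fin n) ℂ,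
      (∀ i, B' i (lo j) = y₁ i) ∧ (∀ i, B' i (hi j) = y₂ i) ∧
        ∀ m, m ≠ lo j → m ≠ hi j → ∀ i, B' i m = B i m := by
    refine ⟨Matrix.of fun i m => if m = lo j then y₁ i else if m = hi j then y₂ i else B i m,
      fun m => ?_, fun m => ?_, fun i h1 h2 m => ?_⟩
    · simp
    · simp [(lo_ne_hi j).symm]
    · simp [h1, h2]
  refine ⟨B', ⟨fun i => ?_, fun i hi' => ?_, fun i hi' => ?_, fun i m h1 h2 => ?_⟩, ?_⟩
  · by_cases hi1 : i = lo j
    · subst hi1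
      rw [B'_lo, (hrow_lo _ rfl).1]
    · by_cases hi2 : i = hi j
      · subst hi2
        rw [B'_hi, hrow_hi _ rfl]
      · rw [B'_ne i hi1 hi2, hB.diag, h.frame_d i hi1 hi2]
  · have h1 : lo i ≠ lo j := fun e => by
      have : i.1 = j.1 := congrArg (Fin.val (n := n)) e
      omega
    have h2 : lo i ≠ hi j := fun e => by
      have : i.1 = j.1 + 1 := congrArg Fin.val e
      omega
    rw [B'_ne _ h1 h2, hB.sub i (by omega)]
  · by_cases hij : i = j
    · subst hij
      rw [B'_hi, (hrow_lo _ rfl).2]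
    · have hne : i.1 ≠ j.1 := fun e => hij (Fin.ext e)
      have h1 : hi i ≠ lo j := fun e => by
        have : i.1 + 1 = j.1 := congrArg Fin.val e
        omega
      have h2 : hi i ≠ hi j := fun e => by
        have : i.1 + 1 = j.1 + 1 := congrArg Fin.val e
        omega
      rw [B'_ne _ h1 h2, hB.sup i (by omega), h.frame_β i hij]
  · by_cases hm1 : m = lo j
    · subst hm1
      rw [B'_lo]
      exact (hrow_up i (by omega)).1
    · by_cases hm2 : m = hi j
      · subst hm2
        rw [B'_hi]
        exact (hrow_up i (by omega)).2
      · have hne1 : m.1 ≠ j.1 := fun e => hm1 (Fin.ext e)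
        have hne2 : m.1 ≠ j.1 + 1 := fun e => hm2 (Fin.ext e)
        rw [B'_ne m hm1 hm2, hB.upper i m h1 (by omega), h.frame_q m hm1 hm2]
  · have := norm_sub_mul_planeRotation_le j G (ε := 17 * u) (by positivity) (M := B) (M' := B')
      (fun m => by rw [B'_lo]; exact e₁ m) (fun m => by rw [B'_hi]; exact e₂ m) B'_ne
    exact this.trans (mul_le_mul_of_nonneg_right (by linarith) (norm_nonneg _))

end BackStep

/-! ### One iteration -/

/-- Composition of two relative perturbations of sizes `η` and `ε`. -/
theorem norm_sub_le_of_relative_errors {E : Type*} [SeminormedAddCommGroup E] {ε η r : ℝ}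
    {x y z x' y' : E} (hε : 0 ≤ ε) (hx : ‖x‖ = r) (hxy : ‖y - x‖ ≤ η * r)
    (hyz : ‖z - y'‖ ≤ ε * ‖y‖) (hiso : ‖y' - x'‖ = ‖y - x‖) :
    ‖z - x'‖ ≤ ((1 + ε) * (1 + η) - 1) * r := by
  have hy : ‖y‖ ≤ (1 + η) * r := by
    have := norm_le_norm_add_norm_sub' y x
    rw [hx] at this
    linarith
  have h1 := norm_sub_le_norm_sub_add_norm_sub z y' x'
  have h2 : ε * ‖y‖ ≤ ε * ((1 + η) * r) := by gcongr
  linarith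

/-- The planes run downwards, so `W t` collects the rotations with indices t, …, n - 2. The
recursion is on the number n - 1 - t of completed passes, with truncated subtraction giving 1 beyond
the range. -/
theorem exists_accumulated_product {n : ℕ} (V : Fin (n - 1) → Matrix (Fin n) (Fin n) ℂ)
    (hV : ∀ j, V j ∈ Matrix.unitaryGroup (Fin n) ℂ) :
    ∃ W : ℕ → Matrix (Fin n) (Fin n) ℂ, W (n - 1) = 1 ∧
      (∀ j : Fin (n - 1), W j.1 = V j * W (j.1 + 1)) ∧
      ∀ t, W t ∈ Matrix.unitaryGroup (Fin n) ℂ := by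
  let P : ℕ → Matrix (Fin n) (Fin n) ℂ := fun m =>
    Nat.rec 1 (fun k X => if h : n - 1 - (k + 1) < n - 1 then V ⟨_, h⟩ * X else 1) m
  have hP : ∀ k, P (k + 1) = if h : n - 1 - (k + 1) < n - 1 then V ⟨_, h⟩ * P k else 1 :=
    fun _ => rfl
  have hU : ∀ m, P m ∈ Matrix.unitaryGroup (Fin n) ℂ := by
    intro m
    induction m with
    | zero => exact one_mem _
    | succ k ih =>
      rw [hP]
      split_ifs with h
      · exact mul_mem (hV _) ih
      · exact one_mem _
  refine ⟨fun t => P (n - 1 - t), ?_, fun j => ?_, fun t => hU _⟩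
  · simp [P]
  · have hj := j.2
    have e : n - 1 - j.1 = n - 1 - (j.1 + 1) + 1 := by omega
    have e' : n - 1 - (n - 1 - (j.1 + 1) + 1) = j.1 := by omega
    change P (n - 1 - j.1) = _
    rw [e, hP, dif_pos (by omega)]
    congr 2
    exact Fin.ext e'

/-- Compare with exp(mε) and use |eˣ - 1 - x| ≤ x² ≤ x on [0, 1]. -/
theorem one_add_pow_sub_one_le {ε : ℝ} (hε : 0 ≤ ε) {m : ℕ} (h : m * ε ≤ 1) :
    (1 + ε) ^ m - 1 ≤ 2 * (m * ε) := by
  have h0 : 0 ≤ m * ε := by positivity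
  have h1 : (1 + ε) ^ m ≤ Real.exp (m * ε) := by
    rw [Real.exp_nat_mul]
    gcongr
    rw [add_comm]
    exact Real.add_one_le_exp ε
  have h2 := Real.abs_exp_sub_one_sub_id_le (x := m * ε) (by rwa [abs_of_nonneg h0])
  have h3 := (abs_le.1 h2).2
  nlinarith

section Iteration

variable {n : ℕ} {u : ℝ} {Q G : Fin (n - 1) → Matrix (Fin 2) (Fin 2) ℂ}
  {W : ℕ → Matrix (Fin n) (Fin n) ℂ}

/-- Here `m` counts completed passes. The matrix and p are followed along the same unitary `W t`,
with relative errors compounding by a factor 1 + 1000u per pass. -/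
theorem elimination_accumulate {g : Generators n} {S : ℕ → ElimState n} (hu1 : u ≤ 1 / 1000)
    (hu : 0 ≤ u)
    (hG : ∀ j, IsNearUnitary u (Q j) (G j)) (hW1 : W (n - 1) = 1)
    (hW : ∀ j : Fin (n - 1), W j.1 = planeRotation j (G j) * W (j.1 + 1))
    (hWU : ∀ t, W t ∈ Matrix.unitaryGroup (Fin n) ℂ)
    (hS : S (n - 1) = ⟨g.d, g.β, fun j => conj (g.β j), g.p, g.q⟩)
    (hstep : ∀ j : Fin (n - 1), IsElimStep u g.q j (S (j.1 + 1)) (Q j) (S j.1)) :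
    ∀ m t : ℕ, t + m = n - 1 → ∃ B, ElimTracks g.q t (S t) B ∧
      ‖B - W t * g.toMatrix‖ ≤ ((1 + 1000 * u) ^ m - 1) * ‖g.toMatrix‖ ∧
      ‖Matrix.replicateCol Unit (S t).p - W t * Matrix.replicateCol Unit g.p‖ ≤
        ((1 + 1000 * u) ^ m - 1) * ‖Matrix.replicateCol Unit g.p‖ := by
  intro m
  induction m with
  | zero =>
    intro t ht
    obtain rfl : t = n - 1 := by omega
    refine ⟨g.toMatrix, ?_, ?_, ?_⟩
    · rw [hS]
      exact ElimTracks.toMatrix g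
    · simp [hW1]
    · simp [hW1, hS]
  | succ m ih =>
    intro t ht
    obtain ⟨B, hB, eB, ep⟩ := ih (t + 1) (by omega)
    have hst := hstep ⟨t, by omega⟩
    have hGt := hG ⟨t, by omega⟩
    have hWt := hW ⟨t, by omega⟩
    have hV := planeRotation_mem_unitaryGroup (⟨t, by omega⟩ : Fin (n - 1)) hGt.unitary
    obtain ⟨B', hB', eB'⟩ := hst.exists_elimTracks hGt hu1 hB
    refine ⟨B', hB', ?_, ?_⟩
    · have := norm_sub_le_of_relative_errors (x' := W t * g.toMatrix) (by positivity)
        (norm_unitary_mul (hWU (t + 1)) _) eB eB'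
        (by rw [hWt, Matrix.mul_assoc, ← Matrix.mul_sub, norm_unitary_mul hV])
      rw [pow_succ']
      linarith
    · have := norm_sub_le_of_relative_errors (x' := W t * Matrix.replicateCol Unit g.p)
        (by positivity) (norm_unitary_mul (hWU (t + 1)) _) ep (hst.norm_p_sub_le hGt hu1)
        (by rw [hWt, Matrix.mul_assoc, ← Matrix.mul_sub, norm_unitary_mul hV])
      rw [pow_succ']
      linarith

/-- The same rotations now act on columns, hence `(W t)ᴴ` on the right, while q is multiplied by `W
t` from the left. -/
theorem rotationBack_accumulate {γ : Fin (n - 1) → ℂ} {p : Fin n → ℂ} {S : ℕ → BackState n}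
    {B : Matrix (Fin n) (Fin n) ℂ} (hu1 : u ≤ 1 / 1000) (hu : 0 ≤ u)
    (hG : ∀ j, IsNearUnitary u (Q j) (G j)) (hW1 : W (n - 1) = 1)
    (hW : ∀ j : Fin (n - 1), W j.1 = planeRotation j (G j) * W (j.1 + 1))
    (hWU : ∀ t, W t ∈ Matrix.unitaryGroup (Fin n) ℂ)
    (hB : BackTracks γ p (n - 1) (S (n - 1)) B)
    (hstep : ∀ j : Fin (n - 1), IsBackStep u (Q j) γ p j (S (j.1 + 1)) (S j.1)) :
    ∀ m t : ℕ, t + m = n - 1 → ∃ M, BackTracks γ p t (S t) M ∧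
      ‖M - B * (W t)ᴴ‖ ≤ ((1 + 1000 * u) ^ m - 1) * ‖B‖ ∧
      ‖Matrix.replicateCol Unit (S t).q - W t * Matrix.replicateCol Unit (S (n - 1)).q‖ ≤
        ((1 + 1000 * u) ^ m - 1) * ‖Matrix.replicateCol Unit (S (n - 1)).q‖ := by
  intro m
  induction m with
  | zero =>
    intro t ht
    obtain rfl : t = n - 1 := by omega
    exact ⟨B, hB, by simp [hW1], by simp [hW1]⟩
  | succ m ih =>
    intro t ht
    obtain ⟨M, hM, eM, eq⟩ := ih (t + 1) (by omega)
    have hst := hstep ⟨t, by omega⟩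
    have hGt := hG ⟨t, by omega⟩
    have hWt := hW ⟨t, by omega⟩
    have hV := planeRotation_mem_unitaryGroup (⟨t, by omega⟩ : Fin (n - 1)) hGt.unitary
    obtain ⟨M', hM', eM'⟩ := hst.exists_backTracks hGt hu1 hM
    refine ⟨M', hM', ?_, ?_⟩
    · have := norm_sub_le_of_relative_errors (x' := B * (W t)ᴴ) (by positivity)
        (norm_mul_conjTranspose_unitary (hWU (t + 1)) _) eM eM'
        (by rw [hWt, Matrix.conjTranspose_mul, ← Matrix.mul_assoc, ← Matrix.sub_mul,
          norm_mul_conjTranspose_unitary hV])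
      rw [pow_succ']
      linarith
    · have := norm_sub_le_of_relative_errors
        (x' := W t * Matrix.replicateCol Unit (S (n - 1)).q)
        (by positivity) (norm_unitary_mul (hWU (t + 1)) _) eq (hst.norm_q_sub_le hGt hu1)
        (by rw [hWt, Matrix.mul_assoc, ← Matrix.mul_sub, norm_unitary_mul hV])
      rw [pow_succ']
      linarith

end Iteration

theorem BackTracks.eq_toMatrix {n : ℕ} {g : Generators n} {γ : Fin (n - 1) → ℂ}
    {s : BackState n} {M : Matrix (Fin n) (Fin n) ℂ} (h : BackTracks γ g.p 0 s M)
    (hd : s.d = g.d) (hβ : s.β = g.β) (hq : s.q = g.q) {i m : Fin n} (him : i ≤ m) :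
    g.toMatrix i m = M i m := by
  simp only [Generators.toMatrix, Matrix.of_apply]
  have him' : i.1 ≤ m.1 := him
  have hm := m.2
  split_ifs with h1 h2 h3 h4
  · subst h1
    rw [h.diag, hd]
  · have := h.sup ⟨i.1, by omega⟩ (Nat.zero_le _)
    rw [hβ] at this
    rw [← this]
    congr 1
    exact Fin.ext h2
  · rw [h.upper i m (by omega) (by omega), hq]
  · exfalso
    omega
  · exact absurd (Fin.ext (by omega)) h1

/-- One iteration in floating point arithmetic: the diagonal and the upper triangular part of
the result agree with those of a small relative perturbation of a unitary conjugate of the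
matrix represented by the input. -/
theorem IsQRIteration.exists_unitary {n : ℕ} {u : ℝ} {g g' : Generators n} (hu : 0 ≤ u)
    (hu1 : u ≤ 1 / 1000) (hun : 2000 * n * u ≤ 1) (h : IsQRIteration u g g') :
    ∃ U ∈ Matrix.unitaryGroup (Fin n) ℂ, ∃ M : Matrix (Fin n) (Fin n) ℂ,
      (∀ i m, i ≤ m → g'.toMatrix i m = M i m) ∧
      ‖M - U * g.toMatrix * Uᴴ‖ ≤ 4000 * n * u * ‖g.toMatrix‖ ∧
      ‖Matrix.replicateCol Unit g'.p - U * Matrix.replicateCol Unit g.p‖ ≤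
        4000 * n * u * ‖Matrix.replicateCol Unit g.p‖ ∧
      ‖Matrix.replicateCol Unit g'.q - U * Matrix.replicateCol Unit g.q‖ ≤
        4000 * n * u * ‖Matrix.replicateCol Unit g.q‖ := by
  obtain ⟨Q, d, γ, ⟨S, hS, hstep, hd, hγ, hp⟩, T, hTd, hTq, hTstep, hd', hβ', hq'⟩ := h
  have hG : ∀ j, ∃ G, IsNearUnitary u (Q j) G := fun j =>
    (hstep j).exists_isNearUnitary hu hu1
  choose G hG using hG
  obtain ⟨W, hW1, hW, hWU⟩ := exists_accumulated_product (fun j => planeRotation j (G j))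
    fun j => planeRotation_mem_unitaryGroup j (hG j).unitary
  obtain ⟨B, hB, eB, ep⟩ := elimination_accumulate hu1 hu hG hW1 hW hWU hS hstep (n - 1) 0
    (by omega)
  -- The loops fit together: at t = 0 the elimination has turned every entry above the diagonal into
  -- -p conj(q), and at t = n - 1 no superdiagonal entry is required to be stored.
  have hB' : BackTracks γ g'.p (n - 1) (T (n - 1)) B :=
    { diag := fun i => by rw [hB.diag, hd, hTd]
      sub := fun j _ => by rw [hB.sub, hγ]
      sup := fun j hj => absurd j.2 (by omega)
      upper := fun i m him _ => by rw [hB.upper i m him (Or.inl (Nat.zero_le _)), hp, hTq] }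
  obtain ⟨M, hM, eM, eq⟩ := rotationBack_accumulate hu1 hu hG hW1 hW hWU hB' hTstep (n - 1) 0
    (by omega)
  rw [hp] at ep
  rw [hTq, hq'] at eq
  have hn : ((n - 1 : ℕ) : ℝ) ≤ n := by exact_mod_cast Nat.sub_le n 1
  have hn0 : (0 : ℝ) ≤ n := Nat.cast_nonneg n
  have hη0 : (0 : ℝ) ≤ (1 + 1000 * u) ^ (n - 1) - 1 := by
    have := one_le_pow₀ (n := n - 1) (by linarith : 1 ≤ 1 + 1000 * u)
    linarith
  -- At most 2(n - 1) passes with ε = 1000u give 2 · 2n · 1000u = 4000nu.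
  have hη2 : (1 + 1000 * u) ^ (n - 1) * (1 + 1000 * u) ^ (n - 1) - 1 ≤ 4000 * n * u := by
    have hnu : ((n - 1 : ℕ) : ℝ) * u ≤ n * u := by gcongr
    rw [← pow_add]
    have := one_add_pow_sub_one_le (ε := 1000 * u) (by positivity) (m := n - 1 + (n - 1))
      (by push_cast; linarith)
    push_cast at this
    linarith
  have hη : (1 + 1000 * u) ^ (n - 1) - 1 ≤ 4000 * n * u := by
    refine le_trans ?_ hη2
    have : (1 + 1000 * u) ^ (n - 1) * 1 ≤ (1 + 1000 * u) ^ (n - 1) * (1 + 1000 * u) ^ (n - 1) := by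
      gcongr
      linarith
    linarith
  refine ⟨W 0, hWU 0, M, fun i m him => hM.eq_toMatrix hd' hβ' hq' him, ?_, ?_, ?_⟩
  · have := norm_sub_le_of_relative_errors (x' := W 0 * g.toMatrix * (W 0)ᴴ) hη0
      (norm_unitary_mul (hWU 0) _) eB eM
      (by rw [← Matrix.sub_mul, norm_mul_conjTranspose_unitary (hWU 0)])
    refine this.trans ?_
    gcongr
    linarith
  · exact ep.trans (by gcongr)
  · exact eq.trans (by gcongr)

/-! ### Many iterations -/

theorem frobenius_norm_le_of_entrywise {m n : Type*} [Fintype m] [Fintype n] {c : ℝ}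
    (hc : 0 ≤ c) {M N : Matrix m n ℂ} (h : ∀ i j, ‖M i j‖ ≤ c * ‖N i j‖) : ‖M‖ ≤ c * ‖N‖ := by
  refine (pow_le_pow_iff_left₀ (norm_nonneg _) (by positivity) two_ne_zero).1 ?_
  rw [mul_pow, frobenius_norm_sq, frobenius_norm_sq, Finset.mul_sum]
  refine Finset.sum_le_sum fun i _ => ?_
  rw [Finset.mul_sum]
  refine Finset.sum_le_sum fun j _ => ?_
  rw [← mul_pow]
  exact pow_le_pow_left₀ (norm_nonneg _) (h i j) 2

/-- A matrix is controlled by its upper triangular part if it is Hermitian off the diagonal. -/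
theorem norm_le_two_mul_of_upper {n : ℕ} {D X : Matrix (Fin n) (Fin n) ℂ}
    (hD : ∀ i m, i ≠ m → D i m = conj (D m i)) (hX : ∀ i m, i ≤ m → D i m = X i m) :
    ‖D‖ ≤ 2 * ‖X‖ := by
  refine (pow_le_pow_iff_left₀ (norm_nonneg _) (by positivity) two_ne_zero).1 ?_
  have h : ‖D‖ ^ 2 ≤ ‖X‖ ^ 2 + ‖X‖ ^ 2 := by
    have hT : ‖X‖ ^ 2 = ∑ i, ∑ j, ‖X j i‖ ^ 2 := by rw [frobenius_norm_sq, Finset.sum_comm]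
    nth_rewrite 2 [hT]
    rw [frobenius_norm_sq, frobenius_norm_sq, ← Finset.sum_add_distrib]
    refine Finset.sum_le_sum fun i _ => ?_
    rw [← Finset.sum_add_distrib]
    refine Finset.sum_le_sum fun m _ => ?_
    rcases le_or_gt i m with him | him
    · rw [hX i m him]
      linarith [sq_nonneg ‖X i m‖, sq_nonneg ‖X m i‖]
    · rw [hD i m him.ne', RCLike.norm_conj, hX m i him.le]
      linarith [sq_nonneg ‖X i m‖, sq_nonneg ‖X m i‖]
  nlinarith [sq_nonneg ‖X‖]

/-- The diagonal is excluded because computed diagonal entries need not be real. -/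
theorem Generators.toMatrix_conj {n : ℕ} (g : Generators n) {i m : Fin n} (him : i ≠ m) :
    g.toMatrix i m = conj (g.toMatrix m i) := by
  have hne : i.1 ≠ m.1 := fun e => him (Fin.ext e)
  simp only [Generators.toMatrix, Matrix.of_apply]
  rw [if_neg him, if_neg him.symm]
  rcases lt_or_gt_of_ne hne with h | h
  · by_cases h1 : i.1 + 1 = m.1
    · rw [dif_pos h1, dif_neg (by omega), if_neg (by omega), dif_pos h1, Complex.conj_conj]
    · rw [dif_neg h1, if_pos (by omega), dif_neg (by omega), if_neg (by omega), dif_neg h1]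
      simp [mul_comm]
  · by_cases h1 : m.1 + 1 = i.1
    · rw [dif_neg (by omega), if_neg (by omega), dif_pos h1, dif_pos h1]
    · rw [dif_neg (by omega), if_neg (by omega), dif_neg h1, dif_neg h1, if_pos (by omega)]
      simp [mul_comm]

/-- If `A'` agrees with `M ≈ U A U*` on and above the diagonal and `A'` is Hermitian off the
diagonal, then `A' ≈ U A U*`, and the skew-Hermitian part grows only by the size of the
perturbation. -/
theorem norm_bounds_of_upper_eq {n : ℕ} {A A' M U : Matrix (Fin n) (Fin n) ℂ} {e : ℝ}
    (hU : U ∈ Matrix.unitaryGroup (Fin n) ℂ) (hA' : ∀ i m, i ≠ m → A' i m = conj (A' m i))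
    (hM : ∀ i m, i ≤ m → A' i m = M i m) (he : ‖M - U * A * Uᴴ‖ ≤ e) :
    ‖A' - A'ᴴ‖ ≤ ‖A - Aᴴ‖ + 2 * e ∧ ‖A' - U * A * Uᴴ‖ ≤ 2 * ‖A - Aᴴ‖ + 2 * e := by
  -- Comparing with the conjugate of the Hermitian part `H`, not of `A`, makes the difference `D`
  -- Hermitian off the diagonal, so its upper triangle controls it. The skew part `K` costs only
  -- half of ‖A - Aᴴ‖.
  set K := (1 / 2 : ℂ) • (A - Aᴴ) with hK
  set H := A - K with hH
  have hHerm : (U * H * Uᴴ)ᴴ = U * H * Uᴴ := by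
    have : Hᴴ = H := by
      rw [hH, hK]
      ext i j
      simp
      ring
    rw [Matrix.conjTranspose_mul, Matrix.conjTranspose_mul, Matrix.conjTranspose_conjTranspose,
      this, Matrix.mul_assoc]
  have hKn : ‖K‖ = ‖A - Aᴴ‖ / 2 := by
    rw [hK, norm_smul]
    norm_num
    ring
  have split : U * A * Uᴴ = U * H * Uᴴ + U * K * Uᴴ := by
    rw [hH, Matrix.mul_sub, Matrix.sub_mul, sub_add_cancel]
  have hKc : ‖U * K * Uᴴ‖ = ‖A - Aᴴ‖ / 2 := by rw [norm_unitary_conj hU, hKn]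
  set X := M - U * H * Uᴴ with hX
  set D := A' - U * H * Uᴴ with hD
  have hXn : ‖X‖ ≤ e + ‖A - Aᴴ‖ / 2 := by
    have : X = (M - U * A * Uᴴ) + U * K * Uᴴ := by rw [hX, split]; abel
    rw [this]
    exact (norm_add_le _ _).trans (add_le_add he hKc.le)
  have hDX : ∀ i m, i ≤ m → D i m = X i m := by
    intro i m him
    rw [hD, hX, Matrix.sub_apply, Matrix.sub_apply, hM i m him]
  have hDc : ∀ i m, i ≠ m → D i m = conj (D m i) := by
    intro i m him
    have h1 : (U * H * Uᴴ) i m = conj ((U * H * Uᴴ) m i) := by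
      conv_lhs => rw [← hHerm]
      rfl
    rw [hD, Matrix.sub_apply, Matrix.sub_apply, hA' i m him, h1, map_sub]
  have hDn := norm_le_two_mul_of_upper hDc hDX
  constructor
  · have h1 : A' - A'ᴴ = D - Dᴴ := by
      rw [hD, Matrix.conjTranspose_sub, hHerm]
      abel
    -- `D - Dᴴ` is diagonal. This yields factor 1 in front of ‖A - Aᴴ‖, which prevents exponential
    -- growth over the iterations.
    have h2 : ‖D - Dᴴ‖ ≤ 2 * ‖X‖ := by
      refine frobenius_norm_le_of_entrywise zero_le_two fun i m => ?_
      by_cases him : i = m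
      · subst him
        rw [Matrix.sub_apply, Matrix.conjTranspose_apply, hDX i i le_rfl]
        refine (norm_sub_le _ _).trans ?_
        rw [norm_star]
        linarith
      · have : (D - Dᴴ) i m = 0 := by
          rw [Matrix.sub_apply, Matrix.conjTranspose_apply, hDc i m him]
          exact sub_self _
        rw [this, norm_zero]
        positivity
    rw [h1]
    linarith
  · have h1 : A' - U * A * Uᴴ = D - U * K * Uᴴ := by rw [hD, split]; abel
    have h2 := norm_sub_le D (U * K * Uᴴ)
    have h3 := norm_nonneg (A - Aᴴ)
    rw [h1]
    linarith

theorem toMatrix_generatorsOf {n : ℕ} {A : Matrix (Fin n) (Fin n) ℂ} {p q : Fin n → ℂ}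
    (hA : A.IsHermitian) (hL : IsLowerHessenberg (A + Matrix.vecMulVec p (star q))) :
    (generatorsOf A p q).toMatrix = A := by
  have upper : ∀ i m : Fin n, i ≤ m → (generatorsOf A p q).toMatrix i m = A i m := by
    intro i m him
    have him' : i.1 ≤ m.1 := him
    simp only [Generators.toMatrix, generatorsOf, Matrix.of_apply]
    split_ifs with h1 h2 h3 h4
    · rw [h1]
    · congr 1
      exact Fin.ext h2
    · have := hL i m h3
      rw [Matrix.add_apply, Matrix.vecMulVec_apply] at this
      exact (eq_neg_of_add_eq_zero_left this).symm
    · omega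
    · exact absurd (Fin.ext (by omega)) h1
  ext i m
  rcases le_or_gt i m with him | him
  · exact upper i m him
  · rw [Generators.toMatrix_conj _ him.ne', upper m i him.le]
    exact hA.apply i m

theorem norm_sub_unitary_mul_step {m n : Type*} [Fintype m] [Fintype n] [DecidableEq m]
    {U V : Matrix m m ℂ} (hV : V ∈ Matrix.unitaryGroup m ℂ) {x y z : Matrix m n ℂ} {e f : ℝ}
    (h₁ : ‖y - U * x‖ ≤ e) (h₂ : ‖z - V * y‖ ≤ f) : ‖z - V * U * x‖ ≤ e + f := by
  have h : z - V * U * x = (z - V * y) + V * (y - U * x) := by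
    rw [Matrix.mul_sub, Matrix.mul_assoc]
    abel
  have := norm_add_le (z - V * y) (V * (y - U * x))
  rw [norm_unitary_mul hV] at this
  rw [h]
  linarith

/-- With θ = 4000nu and norms relative to the initial matrix, the skew part σ and the error E
satisfy σ' ≤ σ + 4θ and E' ≤ E + 2σ + 4θ. From zero initial values this gives σ ≤ 4lθ and E ≤ 4l²θ.
The errors of p and q grow only linearly, but the same quadratic bound serves for them. -/
theorem iterations_accumulate {n k : ℕ} {u : ℝ} {G : ℕ → Generators n} (hu : 0 ≤ u)
    (hu1 : u ≤ 1 / 1000) (hun : 2000 * n * u ≤ 1) (huk : 4 * (k : ℝ) ^ 2 * (4000 * n * u) ≤ 1)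
    (h0 : (G 0).toMatrix.IsHermitian) (hG : ∀ l < k, IsQRIteration u (G l) (G (l + 1))) :
    ∀ l ≤ k, ∃ U ∈ Matrix.unitaryGroup (Fin n) ℂ,
      ‖(G l).toMatrix - (G l).toMatrixᴴ‖ ≤ 4 * l * (4000 * n * u) * ‖(G 0).toMatrix‖ ∧
      ‖(G l).toMatrix - U * (G 0).toMatrix * Uᴴ‖ ≤
        4 * (l : ℝ) ^ 2 * (4000 * n * u) * ‖(G 0).toMatrix‖ ∧
      ‖Matrix.replicateCol Unit (G l).p - U * Matrix.replicateCol Unit (G 0).p‖ ≤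
        4 * (l : ℝ) ^ 2 * (4000 * n * u) * ‖Matrix.replicateCol Unit (G 0).p‖ ∧
      ‖Matrix.replicateCol Unit (G l).q - U * Matrix.replicateCol Unit (G 0).q‖ ≤
        4 * (l : ℝ) ^ 2 * (4000 * n * u) * ‖Matrix.replicateCol Unit (G 0).q‖ := by
  intro l
  induction l with
  | zero =>
    intro _
    refine ⟨1, one_mem _, ?_, ?_, ?_, ?_⟩
    · rw [h0.eq]; simp
    · simp
    · simp
    · simp
  | succ l ih =>
    intro hl
    obtain ⟨U, hU, hσ, hA, hp, hq⟩ := ih (by omega)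
    obtain ⟨V, hV, M, hM, eA, ep, eq⟩ := (hG l (by omega)).exists_unitary hu hu1 hun
    set θ : ℝ := 4000 * n * u with hθ
    have hθ0 : 0 ≤ θ := by positivity
    have hl1 : 4 * (l : ℝ) ^ 2 * θ ≤ 1 := by
      have : (l : ℝ) ≤ k := by exact_mod_cast (by omega : l ≤ k)
      refine le_trans ?_ huk
      gcongr
    -- The smallness of u keeps every iterate within twice its initial norm, so an error relative to
    -- the current iterate is at most twice that relative to the initial data.
    have bound : ∀ {r s : ℝ}, 0 ≤ r → s ≤ r + 4 * (l : ℝ) ^ 2 * θ * r → θ * s ≤ 2 * θ * r := by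
      intro r s hr hs
      have : 4 * (l : ℝ) ^ 2 * θ * r ≤ 1 * r := by gcongr
      have : s ≤ 2 * r := by linarith
      calc θ * s ≤ θ * (2 * r) := by gcongr
        _ = _ := by ring
    have nA := bound (norm_nonneg (G 0).toMatrix) (s := ‖(G l).toMatrix‖) (by
      have := norm_le_norm_add_norm_sub' (G l).toMatrix (U * (G 0).toMatrix * Uᴴ)
      rw [norm_unitary_conj hU] at this
      linarith)
    have nvec : ∀ v w : Fin n → ℂ,
        ‖Matrix.replicateCol Unit v - U * Matrix.replicateCol Unit w‖ ≤
          4 * (l : ℝ) ^ 2 * θ * ‖Matrix.replicateCol Unit w‖ →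
        θ * ‖Matrix.replicateCol Unit v‖ ≤ 2 * θ * ‖Matrix.replicateCol Unit w‖ := by
      intro v w h
      refine bound (norm_nonneg _) ?_
      have := norm_le_norm_add_norm_sub' (Matrix.replicateCol Unit v)
        (U * Matrix.replicateCol Unit w)
      rw [norm_unitary_mul hU] at this
      linarith
    have np := nvec _ _ hp
    have nq := nvec _ _ hq
    obtain ⟨b1, b2⟩ := norm_bounds_of_upper_eq hV
      (fun i m him => (G (l + 1)).toMatrix_conj him) hM eA
    have grow : ∀ r : ℝ, 0 ≤ r → 4 * (l : ℝ) ^ 2 * θ * r + 2 * θ * r ≤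
        4 * ((l : ℝ) + 1) ^ 2 * θ * r := by
      intro r hr
      have h1 : 0 ≤ θ * r := by positivity
      have h2 : 0 ≤ (l : ℝ) * (θ * r) := by positivity
      nlinarith
    refine ⟨V * U, mul_mem hV hU, ?_, ?_, ?_, ?_⟩
    · push_cast
      linarith
    · have h1 : (G (l + 1)).toMatrix - V * U * (G 0).toMatrix * (V * U)ᴴ =
          ((G (l + 1)).toMatrix - V * (G l).toMatrix * Vᴴ) +
            V * ((G l).toMatrix - U * (G 0).toMatrix * Uᴴ) * Vᴴ := by
        rw [Matrix.conjTranspose_mul, Matrix.mul_sub, Matrix.sub_mul]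
        simp only [Matrix.mul_assoc]
        abel
      have h2 := norm_add_le ((G (l + 1)).toMatrix - V * (G l).toMatrix * Vᴴ)
        (V * ((G l).toMatrix - U * (G 0).toMatrix * Uᴴ) * Vᴴ)
      rw [norm_unitary_conj hV] at h2
      rw [h1]
      push_cast
      linarith
    · push_cast
      exact (norm_sub_unitary_mul_step hV hp (ep.trans np)).trans (grow _ (norm_nonneg _))
    · push_cast
      exact (norm_sub_unitary_mul_step hV hq (eq.trans nq)).trans (grow _ (norm_nonneg _))

/-! ### Backward errors as perturbations of the input -/

theorem vecNorm_eq_norm_replicateCol {n : ℕ} (v : Fin n → ℂ) :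
    vecNorm v = ‖Matrix.replicateCol Unit v‖ :=
  (Matrix.frobenius_norm_replicateCol v).symm

theorem exists_vector_perturbation {n : ℕ} {U : Matrix (Fin n) (Fin n) ℂ}
    (hU : U ∈ Matrix.unitaryGroup (Fin n) ℂ) {v w : Fin n → ℂ} {c : ℝ}
    (h : ‖Matrix.replicateCol Unit w - U * Matrix.replicateCol Unit v‖ ≤ c) :
    ∃ δ : Fin n → ℂ, w = U *ᵥ (v + δ) ∧ vecNorm δ ≤ c := by
  have hU' : U * Uᴴ = 1 := Matrix.mem_unitaryGroup_iff.1 hU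
  have hw : U *ᵥ (Uᴴ *ᵥ w) = w := by rw [Matrix.mulVec_mulVec, hU', Matrix.one_mulVec]
  refine ⟨Uᴴ *ᵥ w - v, ?_, ?_⟩
  · rw [add_sub_cancel, hw]
  · rw [vecNorm_eq_norm_replicateCol, ← norm_unitary_mul hU, ← Matrix.replicateCol_mulVec,
      Matrix.mulVec_sub, hw]
    rw [← Matrix.replicateCol_mulVec] at h
    exact h

end StructuredQR

theorem lemma4p4 :
    ∃ (C : ℝ) (a b : ℕ), ∀ n k : ℕ, ∃ u₀ : ℝ, 0 < u₀ ∧ ∀ u : ℝ, 0 ≤ u → u ≤ u₀ →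
      ∀ (A : Matrix (Fin n) (Fin n) ℂ) (p q : Fin n → ℂ),
        A.IsHermitian →
        StructuredQR.IsLowerHessenberg (A + Matrix.vecMulVec p (star q)) →
        ∀ g : StructuredQR.Generators n,
          StructuredQR.IsQRIterations u k (StructuredQR.generatorsOf A p q) g →
          ∃ U ∈ Matrix.unitaryGroup (Fin n) ℂ,
            ∃ (δA : Matrix (Fin n) (Fin n) ℂ) (δp δq : Fin n → ℂ),
              g.toMatrix = U * (A + δA) * Uᴴ ∧
              g.p = U *ᵥ (p + δp) ∧
              g.q = U *ᵥ (q + δq) ∧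
              ‖δA‖ ≤ C * (n : ℝ) ^ a * (k : ℝ) ^ b * ‖A‖ * u ∧
              StructuredQR.vecNorm δp ≤ C * (n : ℝ) ^ a * (k : ℝ) ^ b * StructuredQR.vecNorm p * u ∧
              StructuredQR.vecNorm δq ≤
                C * (n : ℝ) ^ a * (k : ℝ) ^ b * StructuredQR.vecNorm q * u := by
  -- 16000 = 4 · 4000, from 4k² · 4000nu. The shifts n + 1 and k + 1 keep u₀ positive and give u ≤
  -- 1/1000 even for n = 0 or k = 0.
  refine ⟨16000, 1, 2, fun n k => ⟨1 / (16000 * (n + 1) * (k + 1) ^ 2), by positivity, ?_⟩⟩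
  intro u hu huu A p q hA hL g hg
  obtain ⟨G, hG0, hG, rfl⟩ := hg
  have hn : (0 : ℝ) ≤ n := Nat.cast_nonneg n
  have hk : (0 : ℝ) ≤ k := Nat.cast_nonneg k
  have hbd : ∀ c : ℝ, 0 ≤ c → c ≤ 16000 * (n + 1) * (k + 1) ^ 2 → c * u ≤ 1 := by
    intro c hc hc'
    rw [le_div_iff₀ (by positivity)] at huu
    calc c * u ≤ (16000 * (n + 1) * (k + 1) ^ 2) * u := by gcongr
      _ ≤ 1 := by linarith
  have hnk : 0 ≤ (n : ℝ) * k ^ 2 := by positivity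
  have hnk' : 0 ≤ (n : ℝ) * k := by positivity
  have h1 := hbd 1000 (by norm_num) (by nlinarith)
  have h2 := hbd (2000 * n) (by positivity) (by nlinarith)
  have h3 := hbd (4 * (k : ℝ) ^ 2 * (4000 * n)) (by positivity) (by nlinarith)
  have h0 : (G 0).toMatrix = A := by rw [hG0, StructuredQR.toMatrix_generatorsOf hA hL]
  obtain ⟨U, hU, -, eA, ep, eq⟩ := StructuredQR.iterations_accumulate (k := k) hu
    (by linarith) h2 (by linarith) (by rw [h0]; exact hA) hG k le_rfl
  rw [h0] at eA
  obtain ⟨δp, hp, hδp⟩ := StructuredQR.exists_vector_perturbation hU ep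
  obtain ⟨δq, hq, hδq⟩ := StructuredQR.exists_vector_perturbation hU eq
  have hp0 : (G 0).p = p := by rw [hG0]; rfl
  have hq0 : (G 0).q = q := by rw [hG0]; rfl
  rw [hp0] at hp
  rw [hq0] at hq
  rw [hp0, ← StructuredQR.vecNorm_eq_norm_replicateCol] at hδp
  rw [hq0, ← StructuredQR.vecNorm_eq_norm_replicateCol] at hδq
  have hU' : U * Uᴴ = 1 := Matrix.mem_unitaryGroup_iff.1 hU
  have hconj : U * (Uᴴ * (G k).toMatrix * U) * Uᴴ = (G k).toMatrix := by
    rw [← Matrix.mul_assoc, ← Matrix.mul_assoc, hU', Matrix.one_mul, Matrix.mul_assoc, hU',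
      Matrix.mul_one]
  -- The perturbation is the forward error carried back by the similarity, which preserves its norm.
  refine ⟨U, hU, Uᴴ * (G k).toMatrix * U - A, δp, δq, ?_, hp, hq, ?_, ?_, ?_⟩
  · rw [add_sub_cancel, hconj]
  · rw [← StructuredQR.norm_unitary_conj hU, Matrix.mul_sub, Matrix.sub_mul, hconj]
    exact eA.trans_eq (by ring)
  · exact hδp.trans_eq (by ring)
  · exact hδq.trans_eq (by ring)
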